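/- For integers $N,r\ge 1$ let $S_{N,r}$ be the set of $(n_1,\dots,n_r)\in\mathbb Z^r$ with all $n_i\ge 3$ odd and $n_1+\cdots+n_r=N$. Let $\mathbf V_{N,r}\subset\mathbb Q[x_1,\dots,x_r]$ be the $\mathbb Q$-span of the monomials $x_1^{n_1-1}\cdots x_r^{n_r-1}$ with $(n_1,\dots,n_r)\in S_{N,r}$, let $\mathsf{Vect}_{N,r}=\mathbb Q^{S_{N,r}}$ (row vectors), and let $\pi\colon\mathbf V_{N,r}\to\mathsf{Vect}_{N,r}$ be the isomorphism sending a polynomial to its vector of coefficients. For $r\ge2$ put $$\mathbf W_{N,r}=\{P\in\mathbf V_{N,r}\mid P(x_1,\dots,x_r)=P(x_2-x_1,x_2,x_3,\dots,x_r)-P(x_2-x_1,x_1,x_3,\dots,x_r)\}.$$ For a monomial $f=x_1^a$ and $g\in\mathbb Q[x_1,\dots,x_{r-1}]$ define $$(f\mathbin{\underline\circ}g)(x_1,\dots,x_r)=f(x_1)g(x_2,\dots,x_r)+\sum_{i=1}^{r-1}\Bigl(f(x_{i+1}-x_i)\,g(x_1,\dots,\hat x_{i+1},\dots,x_r)-(-1)^{\deg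 f}f(x_i-x_{i+1})\,g(x_1,\dots,\hat x_i,\dots,x_r)\Bigr),$$ where hats mark omitted variables, and let $e\binom{m_1,\dots,m_r}{n_1,\dots,n_r}$ be the coefficient of $x_1^{n_1-1}\cdots x_r^{n_r-1}$ in $x_1^{m_1-1}\mathbin{\underline\circ}(x_1^{m_2-1}\cdots x_{r-1}^{m_r-1})$. Define square matrices with rows $m$ and columns $n$ indexed by $S_{N,r}$: $E_{N,r}=\bigl(e\binom{m_1,\dots,m_r}{n_1,\dots,n_r}\bigr)$; for $2\le j\le r$, $$E^{(j)}_{N,r}=\Bigl(\delta_{(m_1,\dots,m_{r-j}),(n_1,\dots,n_{r-j})}\;e\tbinom{m_{r-j+1},\dots,m_r}{n_{r-j+1},\dots,n_r}\Bigr);$$ $F_{N,r}=E_{N,r}-\mathrm{id}$; and $C_{N,r}=E^{(2)}_{N,r}E^{(3)}_{N,r}\cdots E^{(r-1)}_{N,r}E_{N,r}$. Let $\ker C_{N,r}$ be the space of right annihilators of $C_{N,r}$ over $\mathbb Q$. Finally put $$\mathbb O(x)=\frac{x^3}{1-x^2},\qquad \mathbb S(x)=\frac{x^{12}}{(1-x^4)(1-x^6)}.$$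 **Theorem.** Assume that for all integers $r\ge2$ and $N>0$ the linear map $\mathbf W_{N,r}\to\mathsf{Vect}_{N,r}$, $P\mapsto\pi(P)F_{N,r}$, is injective. Then for every $N>0$ the dimension $\dim_{\mathbb Q}\ker C_{N,4}$ is at least the coefficient of $x^N$ in the power series $3\,\mathbb O(x)^2\,\mathbb S(x)-\mathbb S(x)^2$. -/

import Mathlib

namespace TotallyOdd

open MvPolynomial

/-- The set `S_{N,r}` of `r`-tuples of odd integers `≥ 3` with sum `N`. -/
def S (N r : ℕ) : Finset (Fin r → ℕ) :=
  (Finset.Nat.antidiagonalTuple r N).filter fun n => ∀ i, 3 ≤ n i ∧ Odd (n i)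

/-- The exponent vector `(n_1 - 1, …, n_r - 1)` of the monomial
`x_1^{n_1-1} ⋯ x_r^{n_r-1}` (used for `n_i ≥ 1` only). -/
noncomputable def expo {r : ℕ} (n : Fin r → ℕ) : Fin r →₀ ℕ :=
  Finsupp.equivFunOnFinite.symm fun i => n i - 1

/-- The space `V_{N,r}` of restricted totally even homogeneous polynomials of degree `N - r`. -/
noncomputable def V (N r : ℕ) : Submodule ℚ (MvPolynomial (Fin r) ℚ) :=
  Submodule.span ℚ (Set.range fun m : S N r => monomial (expo m.1) (1 : ℚ))

/-- The space `Vect_{N,r}` of (row) vectors indexed by `S_{N,r}`. -/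
abbrev Vect (N r : ℕ) : Type := S N r → ℚ

/-- The natural isomorphism `π : V_{N,r} → Vect_{N,r}`, which reads off the coefficients. -/
noncomputable def piMap (N r : ℕ) : V N r →ₗ[ℚ] Vect N r :=
  (LinearMap.pi fun n : S N r => MvPolynomial.lcoeff ℚ (expo n.1)).domRestrict (V N r)

/-- `P(x_1, …, x_r) ↦ P(x_2 - x_1, x_2, x_3, …, x_r)`. -/
noncomputable def substA {r : ℕ} (hr : 2 ≤ r) :
    MvPolynomial (Fin r) ℚ →ₐ[ℚ] MvPolynomial (Fin r) ℚ :=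
  aeval fun i : Fin r =>
    if i.val = 0 then X ⟨1, by omega⟩ - X ⟨0, by omega⟩ else X i

/-- `P(x_1, …, x_r) ↦ P(x_2 - x_1, x_1, x_3, …, x_r)`. -/
noncomputable def substB {r : ℕ} (hr : 2 ≤ r) :
    MvPolynomial (Fin r) ℚ →ₐ[ℚ] MvPolynomial (Fin r) ℚ :=
  aeval fun i : Fin r =>
    if i.val = 0 then X ⟨1, by omega⟩ - X ⟨0, by omega⟩
    else if i.val = 1 then X ⟨0, by omega⟩ else X i

/-- The subspace `W_{N,r}` of those `P ∈ V_{N,r}` with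
`P(x_1, …, x_r) = P(x_2 - x_1, x_2, x_3, …, x_r) - P(x_2 - x_1, x_1, x_3, …, x_r)`. -/
noncomputable def W (N r : ℕ) (hr : 2 ≤ r) : Submodule ℚ (V N r) where
  carrier := {P | (P : MvPolynomial (Fin r) ℚ) = substA hr P.1 - substB hr P.1}
  zero_mem' := by simp
  add_mem' := by
    intro P Q hP hQ
    simp only [Set.mem_ofPred_eq, Submodule.coe_add, map_add] at hP hQ ⊢
    linear_combination hP + hQ
  smul_mem' := by
    intro c P hP
    simp only [Set.mem_ofPred_eq, Submodule.coe_smul, map_smul] at hP ⊢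
    rw [← smul_sub, ← hP]

/-- The Ihara action `x_1^a ∘ g` of the monomial `f = x_1^a` on a polynomial `g` in `s` variables.
With `r = s + 1` it is the polynomial
`f(x_1) g(x_2, …, x_r) + ∑_{i=1}^{r-1} (f(x_{i+1} - x_i) g(x_1, …, x̂_{i+1}, …, x_r)
  - (-1)^{deg f} f(x_i - x_{i+1}) g(x_1, …, x̂_i, …, x_r))`;
here `rename p.succAbove g` is `g` evaluated at all the variables but `x_p`, in order. -/
noncomputable def ihara {s : ℕ} (a : ℕ) (g : MvPolynomial (Fin s) ℚ) :
    MvPolynomial (Fin (s + 1)) ℚ :=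
  X 0 ^ a * rename Fin.succ g +
    ∑ i : Fin s,
      ((X i.succ - X i.castSucc) ^ a * rename i.succ.succAbove g -
        (-1) ^ a * (X i.castSucc - X i.succ) ^ a * rename i.castSucc.succAbove g)

/-- `e(m_1, …, m_r; n_1, …, n_r)`, the coefficient of `x_1^{n_1-1} ⋯ x_r^{n_r-1}` in
`x_1^{m_1-1} ∘ (x_1^{m_2-1} ⋯ x_{r-1}^{m_r-1})`, for `r ≥ 1` and entries `≥ 1`.
The value at `r = 0` is a dummy. -/
noncomputable def e : {r : ℕ} → (Fin r → ℕ) → (Fin r → ℕ) → ℚ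
  | 0, _, _ => 0
  | _ + 1, m, n =>
      coeff (expo n) (ihara (m 0 - 1) (monomial (expo fun i => m i.succ) (1 : ℚ)))

/-- The matrix `E_{N,r}`. -/
noncomputable def E (N r : ℕ) : Matrix (S N r) (S N r) ℚ :=
  Matrix.of fun m n => e m.1 n.1

/-- The last `j` entries of an `r`-tuple. -/
def lastEntries {r : ℕ} (j : ℕ) (hj : j ≤ r) (m : Fin r → ℕ) : Fin j → ℕ :=
  fun k => m ⟨r - j + k, by omega⟩

/-- The matrix `E_{N,r}^{(j)}`: a Kronecker delta in the first `r - j` entries times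
`e` of the last `j` entries. -/
noncomputable def Ej (N r j : ℕ) (hj : j ≤ r) : Matrix (S N r) (S N r) ℚ :=
  Matrix.of fun m n =>
    (if ∀ i : Fin r, i.val < r - j → m.1 i = n.1 i then 1 else 0) *
      e (lastEntries j hj m.1) (lastEntries j hj n.1)

/-- The matrix `C_{N,r} = E_{N,r}^{(2)} E_{N,r}^{(3)} ⋯ E_{N,r}^{(r-1)} E_{N,r}`. -/
noncomputable def C (N r : ℕ) : Matrix (S N r) (S N r) ℚ :=
  (List.ofFn fun k : Fin (r - 2) => Ej N r (k.val + 2) (by omega)).prod * E N r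

/-- The matrix `F_{N,r} = E_{N,r} - id`. -/
noncomputable def F (N r : ℕ) : Matrix (S N r) (S N r) ℚ := E N r - 1

/-- The linear map `W_{N,r} → Vect_{N,r}`, `P ↦ π(P) F_{N,r}` (row vector times matrix). -/
noncomputable def tasakaMap (N r : ℕ) (hr : 2 ≤ r) : W N r hr →ₗ[ℚ] Vect N r :=
  (F N r).vecMulLinear ∘ₗ piMap N r ∘ₗ (W N r hr).subtype

/-- `O(x) = x^3 / (1 - x^2)`. -/
noncomputable def oddSeries : PowerSeries ℚ :=
  PowerSeries.X ^ 3 * (1 - PowerSeries.X ^ 2)⁻¹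

/-- `S(x) = x^12 / ((1 - x^4) (1 - x^6))`. -/
noncomputable def cuspSeries : PowerSeries ℚ :=
  PowerSeries.X ^ 12 * ((1 - PowerSeries.X ^ 4) * (1 - PowerSeries.X ^ 6))⁻¹

end TotallyOdd

/-! ### Univariate polynomials with dihedral antisymmetry -/

namespace Polynomial

/-! Left and right kernels of a square matrix have equal dimension, so `C` may be studied through
its action on row vectors, which correspond to polynomials. There `E` is the Ihara action `iharaOp`,
and `E^(r-1)` is the same operator on all variables but the first, `tailIharaOp`, each followed by
truncation to totally even restricted monomials. The truncation between the two factors is harmless: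
the monomials it discards contribute nothing to the final coefficients
(`coeff_iharaOp_monomial_eq_zero`, `vecMul_Ej_tail_vecMul_E`).

For `r = 3, 4` and `v` in `W`, the defining relation and the antisymmetry it implies give `vF =
-vE^(r-1)` and `vFE = 0`. Hence `vF` lies in the left kernel of `E` and, under a suitable condition
on `v`, in the image of the preceding factors of `C`. By the injectivity hypothesis such vectors
contribute as many dimensions as there are admissible `v` (`finrank_ker_add_finrank_vecW_le`).

Outer products supply the remaining dimensions, since `E^(j)` sees only the last `j` entries. Let
`k`, `q`, `w` be the generating series of the dimensions of the left kernel of `E_{N,2}`, of its row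
space, and of `W_{N,2}`, and let `K₃`, `K₄` be those of the left kernels of `C_{N,3}` and `C_{N,4}`.
Then, coefficientwise, `K₃ ≥ O k + w O` and `K₄ ≥ O K₃ + w q` (`le_finrank_ker_leftC₃`,
`le_finrank_ker_leftC₄`). With `q = O² - k` and `S ≤ w ≤ k`, `w ≤ O²`, this yields the bound
(`coeff_le_of_kernel_estimates`).

The inequality `S ≤ w` is the lower bound for even period polynomials (`le_finrank_vecW`): the
defect of the period relation on an antisymmetric form is antisymmetric under a dihedral group of
order 6, and so is killed by few linear conditions (`Polynomial.eq_zero_of_dihedral_antisymm`). -/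

theorem coeff_comp_one_sub_X {q : ℚ[X]} {d : ℕ} (hdeg : q.natDegree ≤ d) :
    (q.comp (1 - X)).coeff d = q.coeff d * (-1) ^ d := by
  have hX : (1 - X : ℚ[X]) = -(X - C 1) := by simp
  have hd : (1 - X : ℚ[X]).natDegree = 1 := by
    rw [hX, natDegree_neg, natDegree_X_sub_C]
  have hl : (1 - X : ℚ[X]).leadingCoeff = -1 := by
    rw [hX, leadingCoeff_neg, leadingCoeff_X_sub_C]
  rcases hdeg.lt_or_eq with h | h
  · rw [coeff_eq_zero_of_natDegree_lt h, zero_mul]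
    apply coeff_eq_zero_of_natDegree_lt
    rw [natDegree_comp, hd]
    omega
  · have h5 := coeff_comp_degree_mul_degree (p := q) (q := 1 - X) (by rw [hd]; omega)
    rw [hd, hl, mul_one, h] at h5
    rw [h5, ← h]
    rfl

theorem coeff_sub_of_reciprocal {q : ℚ[X]} {w : ℕ} (hdeg : q.natDegree ≤ w)
    (h2 : ∀ x : ℚ, x ≠ 0 → x ^ w * q.eval x⁻¹ = -q.eval x) {k : ℕ} (hk : k ≤ w) :
    q.coeff (w - k) = -q.coeff k := by
  -- The reciprocity holds at all nonzero rationals, hence as an identity between `q` and its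
  -- coefficient reversal.
  have h : reflect w q = -q := by
    apply eq_of_infinite_eval_eq
    apply Set.Infinite.mono (s := {0}ᶜ) _ (Set.finite_singleton (0 : ℚ)).infinite_compl
    intro x hx
    have hx : x ≠ 0 := hx
    let _ := invertibleOfNonzero (inv_ne_zero hx)
    have h3 := eval₂_reflect_mul_pow (RingHom.id ℚ) x⁻¹ w q hdeg
    simp only [invOf_eq_inv, inv_inv, eval₂_id] at h3
    have h4 := h2 x hx
    rw [← h3] at h4
    have : x ^ w * (eval x (reflect w q) * x⁻¹ ^ w) = eval x (reflect w q) := by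
      rw [inv_pow]; field_simp
    simp only [Set.mem_ofPred_eq, eval_neg]
    linarith
  have h3 := congrArg (fun p => p.coeff k) h
  simpa [coeff_reflect, revAt_le hk] using h3

/-- A polynomial of formal degree `w` that is antisymmetric under `t ↦ 1 - t` and under
`t ↦ 1 / t` vanishes as soon as its first `w / 6` coefficients of odd index do. -/
theorem eq_zero_of_dihedral_antisymm {q : ℚ[X]} {w : ℕ} (hw : Even w) (hdeg : q.natDegree ≤ w)
    (h1 : q.comp (1 - X) = -q) (h2 : ∀ x : ℚ, x ≠ 0 → x ^ w * q.eval x⁻¹ = -q.eval x)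
    (h0 : ∀ k, k < w / 6 → q.coeff (2 * k + 1) = 0) : q = 0 := by
  by_contra hq
  -- Odd indices are the hypothesis. For even `k`, vanishing below `k` bounds the degree by `w - k`
  -- through reciprocity, and `t ↦ 1 - t` preserves the coefficient of that even degree while
  -- antisymmetry negates it.
  have hc : ∀ k < 2 * (w / 6) + 1, q.coeff k = 0 := by
    intro k
    induction k using Nat.strong_induction_on with
    | _ k ih =>
    intro hk
    rcases Nat.even_or_odd k with he | ⟨l, hl⟩
    · have hd : q.natDegree ≤ w - k := by
        rw [natDegree_le_iff_coeff_eq_zero]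
        intro j hj
        by_cases hjw : j ≤ w
        · have := coeff_sub_of_reciprocal hdeg h2 (Nat.sub_le w j)
          rw [Nat.sub_sub_self hjw] at this
          rw [this, ih (w - j) (by omega) (by omega), neg_zero]
        · exact coeff_eq_zero_of_natDegree_lt (by omega)
      have h3 := coeff_comp_one_sub_X hd
      have h4 := coeff_sub_of_reciprocal hdeg h2 (k := k) (by omega)
      rw [h1, coeff_neg, h4, ((Nat.even_sub (by omega)).2 (iff_of_true hw he)).neg_one_pow] at h3
      linarith
    · rw [hl]; exact h0 l (by omega)
  set m := 2 * (w / 6) + 1 with hm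
  have hd : q.natDegree ≤ w - m := by
    rw [natDegree_le_iff_coeff_eq_zero]
    intro j hj
    by_cases hjw : j ≤ w
    · have := coeff_sub_of_reciprocal hdeg h2 (Nat.sub_le w j)
      rw [Nat.sub_sub_self hjw] at this
      rw [this, hc (w - j) (by omega), neg_zero]
    · exact coeff_eq_zero_of_natDegree_lt (by omega)
  have e1 : ∀ x : ℚ, q.eval (1 - x) = -q.eval x := fun x => by
    have := congrArg (eval x) h1
    simpa [eval_comp] using this
  -- Antisymmetry forces zeros at the points `-1`, `1/2` fixed by `t ↦ 1/t`, `t ↦ 1 - t`, and at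
  -- `2`, the image of `-1` under the latter.
  have r1 : q.eval (-1) = 0 := by
    have := h2 (-1) (by norm_num)
    rw [hw.neg_one_pow, inv_neg, inv_one] at this
    linarith
  have r2 : q.eval 2 = 0 := by
    have := e1 (-1)
    norm_num [r1] at this
    exact this
  have r3 : q.eval (1 / 2) = 0 := by
    have := e1 (1 / 2)
    norm_num at this ⊢
    linarith
  have d0 : (X - C 0) ^ m ∣ q := by
    rw [C_0, sub_zero, X_pow_dvd_iff]
    exact hc
  have d1 : (X - C 1) ^ m ∣ q := by
    obtain ⟨g, hg⟩ := d0
    have : q = -(q.comp (1 - X)) := by rw [h1, neg_neg]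
    rw [this, dvd_neg, hg]
    simp only [map_zero, sub_zero, mul_comp, pow_comp, X_comp]
    apply Dvd.dvd.mul_right
    rw [show (1 - X : ℚ[X]) = -(X - C 1) by simp, neg_pow]
    exact Dvd.intro_left _ rfl
  have cop : ∀ {a b : ℚ} (i j : ℕ), a ≠ b → IsCoprime ((X - C a) ^ i) ((X - C b) ^ j) :=
    fun i j hab => (isCoprime_X_sub_C_of_isUnit_sub (sub_ne_zero_of_ne hab).isUnit).pow
  have dvd1 : ∀ {a : ℚ}, q.eval a = 0 → (X - C a) ^ 1 ∣ q := fun h => by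
    rw [pow_one]; exact dvd_iff_isRoot.2 h
  have D1 := (cop m m (by norm_num)).mul_dvd d0 d1
  have D2 := ((cop m 1 (by norm_num)).mul_left (cop m 1 (by norm_num))).mul_dvd D1 (dvd1 r1)
  have D3 := (((cop m 1 (by norm_num)).mul_left (cop m 1 (by norm_num))).mul_left
    (cop 1 1 (by norm_num))).mul_dvd D2 (dvd1 r2)
  have D4 := ((((cop m 1 (by norm_num)).mul_left (cop m 1 (by norm_num))).mul_left
    (cop 1 1 (by norm_num))).mul_left (cop 1 1 (by norm_num))).mul_dvd D3 (dvd1 r3)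
  -- Zeros of order `m` at `0` and `1` and three simple zeros give `2m + 3 ≤ w - m`, that is `6⌊w/6⌋
  -- + 6 ≤ w`, which is absurd.
  have hle := natDegree_le_of_dvd D4 hq
  have mon : ∀ (a : ℚ) (i : ℕ), ((X - C a) ^ i).Monic := fun a i => (monic_X_sub_C a).pow i
  rw [(((mon _ _).mul (mon _ _)).mul (mon _ _)).mul (mon _ _) |>.natDegree_mul (mon _ _),
    ((mon _ _).mul (mon _ _)).mul (mon _ _) |>.natDegree_mul (mon _ _),
    (mon _ _).mul (mon _ _) |>.natDegree_mul (mon _ _), (mon _ _).natDegree_mul (mon _ _)] at hle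
  simp only [natDegree_pow, natDegree_X_sub_C] at hle
  omega

end Polynomial

namespace TotallyOdd

open MvPolynomial

/-! ### Coefficient vectors and polynomials -/

theorem mem_S {N r : ℕ} {n : Fin r → ℕ} :
    n ∈ S N r ↔ ∑ i, n i = N ∧ ∀ i, 3 ≤ n i ∧ Odd (n i) := by
  simp [S, Finset.Nat.mem_antidiagonalTuple]

theorem expo_apply {r : ℕ} (n : Fin r → ℕ) (i : Fin r) : expo n i = n i - 1 := rfl

theorem expo_inj {N r : ℕ} {m n : S N r} (h : expo m.1 = expo n.1) : m = n := by
  ext i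
  have h1 := DFunLike.congr_fun h i
  rw [expo_apply, expo_apply] at h1
  have := ((mem_S.1 m.2).2 i).1
  have := ((mem_S.1 n.2).2 i).1
  omega

/-- The polynomial with a given vector of coefficients. -/
noncomputable def toPoly (N r : ℕ) : Vect N r →ₗ[ℚ] MvPolynomial (Fin r) ℚ :=
  Fintype.linearCombination ℚ fun m : S N r => monomial (expo m.1) (1 : ℚ)

theorem toPoly_apply {N r : ℕ} (v : Vect N r) :
    toPoly N r v = ∑ m : S N r, v m • monomial (expo m.1) (1 : ℚ) :=
  Fintype.linearCombination_apply _ _ _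

theorem toPoly_single {N r : ℕ} (m : S N r) :
    toPoly N r (Pi.single m 1) = monomial (expo m.1) 1 := by
  simp [toPoly, Fintype.linearCombination_apply_single]

theorem toPoly_mem_V {N r : ℕ} (v : Vect N r) : toPoly N r v ∈ V N r := by
  rw [toPoly_apply]
  exact Submodule.sum_mem _ fun m _ => Submodule.smul_mem _ _ (Submodule.subset_span ⟨m, rfl⟩)

theorem coeff_toPoly {N r : ℕ} (v : Vect N r) (n : S N r) :
    coeff (expo n.1) (toPoly N r v) = v n := by
  rw [toPoly_apply, coeff_sum, Finset.sum_eq_single n]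
  · simp
  · intro m _ hm
    rw [coeff_smul, coeff_monomial, if_neg fun h => hm (expo_inj h), smul_zero]
  · simp

theorem coeff_toPoly_eq_zero {N r : ℕ} (v : Vect N r) {d : Fin r →₀ ℕ}
    (hd : ∀ n : S N r, expo n.1 ≠ d) : coeff d (toPoly N r v) = 0 := by
  rw [toPoly_apply, coeff_sum]
  exact Finset.sum_eq_zero fun m _ => by rw [coeff_smul, coeff_monomial, if_neg (hd m), smul_zero]

/-- The space of coefficient vectors of the elements of `W`. -/
noncomputable def vecW (N r : ℕ) (hr : 2 ≤ r) : Submodule ℚ (Vect N r) :=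
  LinearMap.ker (toPoly N r - ((substA hr).toLinearMap - (substB hr).toLinearMap) ∘ₗ toPoly N r)

theorem mem_vecW {N r : ℕ} {hr : 2 ≤ r} {v : Vect N r} :
    v ∈ vecW N r hr ↔
      toPoly N r v = substA hr (toPoly N r v) - substB hr (toPoly N r v) := by
  rw [vecW, LinearMap.mem_ker, LinearMap.sub_apply, sub_eq_zero]
  rfl

theorem eq_zero_of_vecMul_F {N r : ℕ} {hr : 2 ≤ r}
    (hinj : Function.Injective (tasakaMap N r hr)) {v : Vect N r} (hv : v ∈ vecW N r hr)
    (h : Matrix.vecMul v (F N r) = 0) : v = 0 := by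
  let P : W N r hr := ⟨⟨toPoly N r v, toPoly_mem_V v⟩, mem_vecW.1 hv⟩
  have hP : piMap N r P.1 = v := funext fun n => coeff_toPoly v n
  have h1 : tasakaMap N r hr P = 0 := by
    change Matrix.vecMul (piMap N r P.1) (F N r) = 0
    rw [hP, h]
  have h2 : P = 0 := hinj (h1.trans (map_zero _).symm)
  rw [← hP, h2]
  simp

/-! ### A lower bound for the space of even restricted period polynomials -/

section Period

variable {R : Type*} [CommRing R] [Algebra ℚ R]

/-- The values of the binary form with given coefficients. -/
def binaryForm {N : ℕ} (v : Vect N 2) (x y : R) : R :=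
  ∑ n : S N 2, v n • (x ^ (n.1 0 - 1) * y ^ (n.1 1 - 1))

theorem aeval_toPoly_two {N : ℕ} (v : Vect N 2) (x : Fin 2 → R) :
    aeval x (toPoly N 2 v) = binaryForm v (x 0) (x 1) := by
  rw [toPoly_apply, map_sum, binaryForm]
  refine Finset.sum_congr rfl fun n _ => ?_
  rw [map_smul, aeval_monomial, map_one, one_mul, Finsupp.prod_fintype _ _ (by simp),
    Fin.prod_univ_two]
  rfl

theorem map_binaryForm {R' : Type*} [CommRing R'] [Algebra ℚ R'] (φ : R →ₐ[ℚ] R') {N : ℕ}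
    (v : Vect N 2) (x y : R) : φ (binaryForm v x y) = binaryForm v (φ x) (φ y) := by
  simp [binaryForm, map_sum, map_smul]

theorem entries_two {N : ℕ} (n : S N 2) :
    n.1 0 + n.1 1 = N ∧ (3 ≤ n.1 0 ∧ Odd (n.1 0)) ∧ 3 ≤ n.1 1 ∧ Odd (n.1 1) := by
  have h := mem_S.1 n.2
  rw [Fin.sum_univ_two] at h
  exact ⟨h.1, h.2 0, h.2 1⟩

theorem binaryForm_neg_left {N : ℕ} (v : Vect N 2) (x y : R) :
    binaryForm v (-x) y = binaryForm v x y := by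
  refine Finset.sum_congr rfl fun n _ => ?_
  rw [(Nat.Odd.sub_odd (entries_two n).2.1.2 odd_one).neg_pow]

theorem binaryForm_mul {N : ℕ} (v : Vect N 2) (t x y : R) :
    binaryForm v (t * x) (t * y) = t ^ (N - 2) * binaryForm v x y := by
  rw [binaryForm, binaryForm, Finset.mul_sum]
  refine Finset.sum_congr rfl fun n _ => ?_
  have := entries_two n
  rw [show N - 2 = (n.1 0 - 1) + (n.1 1 - 1) by omega, mul_smul_comm]
  ring_nf

/-- Exchange of the two entries. -/
def swapTwo (N : ℕ) : S N 2 ≃ S N 2 where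
  toFun n := ⟨![n.1 1, n.1 0], by
    have := entries_two n
    simp only [mem_S, Fin.sum_univ_two, Fin.forall_fin_two, Matrix.cons_val_zero,
      Matrix.cons_val_one]
    exact ⟨by omega, this.2.2, this.2.1⟩⟩
  invFun n := ⟨![n.1 1, n.1 0], by
    have := entries_two n
    simp only [mem_S, Fin.sum_univ_two, Fin.forall_fin_two, Matrix.cons_val_zero,
      Matrix.cons_val_one]
    exact ⟨by omega, this.2.2, this.2.1⟩⟩
  left_inv n := by ext i; fin_cases i <;> rfl
  right_inv n := by ext i; fin_cases i <;> rfl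

theorem binaryForm_swap {N : ℕ} {v : Vect N 2} (hv : ∀ n, v (swapTwo N n) = -v n) (x y : R) :
    binaryForm v y x = -binaryForm v x y := by
  rw [binaryForm, binaryForm, ← (swapTwo N).sum_comp, ← Finset.sum_neg_distrib]
  refine Finset.sum_congr rfl fun n _ => ?_
  rw [hv, neg_smul, mul_comm]
  rfl

/-- The defect of the period relation, dehomogenized. -/
noncomputable def periodDefect (N : ℕ) : Vect N 2 →ₗ[ℚ] Polynomial ℚ where
  toFun v := binaryForm v Polynomial.X 1 - binaryForm v (1 - Polynomial.X) 1 +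
    binaryForm v (1 - Polynomial.X) Polynomial.X
  map_add' v w := by
    simp only [binaryForm, Pi.add_apply, add_smul, Finset.sum_add_distrib]
    ring
  map_smul' c v := by
    simp only [binaryForm, Pi.smul_apply, smul_assoc, ← Finset.smul_sum, smul_add, smul_sub,
      RingHom.id_apply]

theorem eval_periodDefect {N : ℕ} (v : Vect N 2) (x : ℚ) :
    (periodDefect N v).eval x =
      binaryForm v x 1 - binaryForm v (1 - x) 1 + binaryForm v (1 - x) x := by
  have h : ∀ f g : Polynomial ℚ, (binaryForm v f g).eval x = binaryForm v (f.eval x) (g.eval x) :=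
    fun f g => map_binaryForm (Polynomial.aeval x) v f g
  simp [periodDefect, h]

theorem natDegree_binaryForm_le {N : ℕ} (v : Vect N 2) {x y : Polynomial ℚ}
    (hx : x.natDegree ≤ 1) (hy : y.natDegree ≤ 1) : (binaryForm v x y).natDegree ≤ N - 2 := by
  refine Polynomial.natDegree_sum_le_of_forall_le _ _ fun n _ => ?_
  have := entries_two n
  refine (Polynomial.natDegree_smul_le _ _).trans ?_
  refine (Polynomial.natDegree_mul_le_of_le (Polynomial.natDegree_pow_le_of_le _ hx)
    (Polynomial.natDegree_pow_le_of_le _ hy)).trans ?_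
  omega

/-- Antisymmetry of the form, its evenness in the first argument and its homogeneity make the defect
antisymmetric under `x ↦ 1 - x` and `x ↦ 1/x`. -/
theorem periodDefect_eq_zero {N : ℕ} (hN : Even N) {v : Vect N 2}
    (hv : ∀ n, v (swapTwo N n) = -v n)
    (h0 : ∀ k, k < (N - 2) / 6 → (periodDefect N v).coeff (2 * k + 1) = 0) :
    periodDefect N v = 0 := by
  have hX : (1 - Polynomial.X : Polynomial ℚ).natDegree ≤ 1 := by compute_degree
  refine Polynomial.eq_zero_of_dihedral_antisymm (w := N - 2) ?_ ?_ ?_ ?_ h0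
  · exact hN.tsub even_two
  · refine Polynomial.natDegree_add_le_of_degree_le
      ((Polynomial.natDegree_sub_le _ _).trans (max_le ?_ ?_)) ?_ <;>
      apply natDegree_binaryForm_le <;> simp [hX]
  · refine Polynomial.funext fun x => ?_
    rw [Polynomial.eval_comp, Polynomial.eval_neg, eval_periodDefect, eval_periodDefect]
    simp only [Polynomial.eval_sub, Polynomial.eval_one, Polynomial.eval_X, sub_sub_cancel]
    rw [binaryForm_swap hv (1 - x) x]
    ring
  · intro x hx
    rw [eval_periodDefect, eval_periodDefect, mul_add, mul_sub, ← binaryForm_mul,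
      ← binaryForm_mul, ← binaryForm_mul]
    rw [mul_one, mul_sub, mul_inv_cancel₀ hx, mul_one, ← neg_sub 1 x, binaryForm_neg_left,
      binaryForm_neg_left, binaryForm_swap hv x 1]
    ring

theorem mem_vecW_of_periodDefect {N : ℕ} {v : Vect N 2} (h : periodDefect N v = 0) :
    v ∈ vecW N 2 le_rfl := by
  rw [mem_vecW, ← sub_eq_zero]
  have hA : ∀ z : Fin 2 → ℚ, aeval z (substA le_rfl (toPoly N 2 v)) =
      binaryForm v (z 1 - z 0) (z 1) := fun z => by
    rw [substA, ← AlgHom.comp_apply, comp_aeval, aeval_toPoly_two]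
    simp
  have hB : ∀ z : Fin 2 → ℚ, aeval z (substB le_rfl (toPoly N 2 v)) =
      binaryForm v (z 1 - z 0) (z 0) := fun z => by
    rw [substB, ← AlgHom.comp_apply, comp_aeval, aeval_toPoly_two]
    simp
  set Q := toPoly N 2 v - (substA le_rfl (toPoly N 2 v) - substB le_rfl (toPoly N 2 v)) with hQ
  -- Dehomogenizing requires `x_2 ≠ 0`; the factor `X 1` covers the points with `x_2 = 0`.
  have h1 : X 1 * Q = 0 := by
    refine MvPolynomial.funext fun z => ?_
    rw [map_mul, map_zero, eval_X]
    by_cases hz : z 1 = 0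
    · rw [hz, zero_mul]
    have h2 : aeval z Q = 0 := by
      rw [hQ, map_sub, map_sub, hA, hB, aeval_toPoly_two]
      have h3 := eval_periodDefect v (z 0 / z 1)
      rw [h, Polynomial.eval_zero] at h3
      have h4 := congrArg (fun u => z 1 ^ (N - 2) * u) h3
      simp only [mul_zero, mul_add, mul_sub, ← binaryForm_mul, mul_one, mul_div_cancel₀ _ hz] at h4
      linarith
    rw [← coe_aeval_eq_eval]
    exact mul_eq_zero_of_right _ h2
  exact (mul_eq_zero.1 h1).resolve_left (X_ne_zero 1)

/-- Antisymmetric vectors from the coefficients with first entry smaller than the second. -/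
def antisymmVec (N : ℕ) : (ℕ → ℚ) →ₗ[ℚ] Vect N 2 where
  toFun c n := if n.1 0 < n.1 1 then c (n.1 0 / 2) else
    if n.1 1 < n.1 0 then -c (n.1 1 / 2) else 0
  map_add' c d := by
    ext n
    simp only [Pi.add_apply]
    split_ifs <;> ring
  map_smul' a c := by
    ext n
    simp only [Pi.smul_apply, smul_eq_mul, RingHom.id_apply]
    split_ifs <;> ring

theorem antisymmVec_swap {N : ℕ} (c : ℕ → ℚ) (n : S N 2) :
    antisymmVec N c (swapTwo N n) = -antisymmVec N c n := by
  change (if n.1 1 < n.1 0 then c (n.1 1 / 2) else if n.1 0 < n.1 1 then -c (n.1 0 / 2) else 0) =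
    -(if n.1 0 < n.1 1 then c (n.1 0 / 2) else if n.1 1 < n.1 0 then -c (n.1 1 / 2) else 0)
  split_ifs <;> first | omega | simp

/-- A dimension count: `(N/2 - 2)/2` is the number of odd `n ≥ 3` with `n < N - n`, the free
coefficients of an antisymmetric form, and `(N - 2)/6` linear conditions suffice to kill the defect.
-/
theorem le_finrank_vecW {N : ℕ} (hN : Even N) :
    (N / 2 - 2) / 2 - (N - 2) / 6 ≤ Module.finrank ℚ (vecW N 2 le_rfl) := by
  set a := (N / 2 - 2) / 2 with ha
  set f := (N - 2) / 6 with hf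
  -- The shift by one arises because the entry `2i + 3` has index `(2i + 3)/2 = i + 1` in
  -- `antisymmVec`.
  let ι : (Fin a → ℚ) →ₗ[ℚ] Vect N 2 := antisymmVec N ∘ₗ
    LinearMap.pi fun k => if h : 1 ≤ k ∧ k - 1 < a then LinearMap.proj ⟨k - 1, h.2⟩ else 0
  let Φ : (Fin a → ℚ) →ₗ[ℚ] (Fin f → ℚ) := LinearMap.pi fun k =>
    Polynomial.lcoeff ℚ (2 * k.1 + 1) ∘ₗ periodDefect N ∘ₗ ι
  have hι : Function.Injective ι := by
    rw [← LinearMap.ker_eq_bot, LinearMap.ker_eq_bot']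
    intro c hc
    ext i
    obtain ⟨M, hM⟩ := hN
    have hi := i.2
    have h := congrFun hc ⟨![2 * i + 3, N - (2 * i + 3)], by
      simp only [mem_S, Fin.sum_univ_two, Fin.forall_fin_two, Matrix.cons_val_zero,
        Matrix.cons_val_one]
      refine ⟨by omega, ⟨by omega, ⟨i + 1, by ring⟩⟩, by omega, ⟨M - i - 2, by omega⟩⟩⟩
    have h1 : 2 * i.1 + 3 < N - (2 * i + 3) := by omega
    have h2 : (2 * i.1 + 3) / 2 = i + 1 := by omega
    simpa [ι, antisymmVec, h1, h2] using h
  have hmem : ∀ c ∈ LinearMap.ker Φ, ι c ∈ vecW N 2 le_rfl := fun c hc =>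
    mem_vecW_of_periodDefect (periodDefect_eq_zero hN (antisymmVec_swap _)
      fun k hk => congrFun hc ⟨k, hk⟩)
  have h1 := LinearMap.finrank_range_add_finrank_ker Φ
  have h2 : Module.finrank ℚ (LinearMap.range Φ) ≤ f := by
    simpa using Submodule.finrank_le (LinearMap.range Φ)
  have h3 : Module.finrank ℚ (LinearMap.ker Φ) ≤ Module.finrank ℚ (vecW N 2 le_rfl) :=
    LinearMap.finrank_le_finrank_of_injective (f := ι.restrict hmem)
      fun x y hxy => Subtype.ext (hι (congrArg Subtype.val hxy))
  rw [Module.finrank_fin_fun] at h1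
  omega

end Period

/-! ### Generating series -/

section Series

theorem card_S_one (n : ℕ) : (S n 1).card = if 3 ≤ n ∧ Odd n then 1 else 0 := by
  rw [S, Finset.Nat.antidiagonalTuple_one, Finset.filter_singleton]
  split_ifs with h1 h2 h2
  · rfl
  · exact absurd (h1 0) h2
  · exact absurd (fun i => by simpa [Fin.fin_one_eq_zero i] using h2) h1
  · rfl

theorem card_S_two (n : ℕ) :
    (S n 2).card = ∑ x ∈ Finset.HasAntidiagonal.antidiagonal n, (S x.1 1).card * (S x.2 1).card := by
  rw [S, Finset.Nat.antidiagonalTuple_two, Finset.filter_map, Finset.card_map, Finset.card_filter]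
  refine Finset.sum_congr rfl fun x _ => ?_
  rw [card_S_one, card_S_one, ite_zero_mul_ite_zero, mul_one]
  simp [Fin.forall_fin_two]

theorem oddSeries_eq : oddSeries = PowerSeries.mk fun n => ((S n 1).card : ℚ) := by
  symm
  rw [oddSeries, PowerSeries.eq_mul_inv_iff_mul_eq (by simp)]
  ext n
  rw [mul_sub, mul_one, map_sub, PowerSeries.coeff_mul_X_pow', PowerSeries.coeff_mk,
    PowerSeries.coeff_mk, PowerSeries.coeff_X_pow, sub_eq_iff_eq_add, card_S_one, card_S_one]
  have hodd : ∀ m, Odd m ↔ m % 2 = 1 := fun m => Nat.odd_iff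
  simp only [hodd]
  split_ifs <;> first | omega | norm_num

theorem oddSeries_sq : oddSeries ^ 2 = PowerSeries.mk fun n => ((S n 2).card : ℚ) := by
  ext n
  rw [sq, oddSeries_eq, PowerSeries.coeff_mul, PowerSeries.coeff_mk, card_S_two]
  simp

/-- The dimension of the space of cusp forms of weight `n` and level one. -/
def cuspDim (n : ℕ) : ℕ := if Even n then (n / 2 - 2) / 2 - (n - 2) / 6 else 0

theorem cuspDim_of_odd {n : ℕ} (hn : n % 2 = 1) : cuspDim n = 0 :=
  if_neg (by rw [Nat.even_iff]; omega)

theorem cuspDim_two_mul (M : ℕ) : cuspDim (2 * M) = (M - 2) / 2 - (M - 1) / 3 := by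
  rw [cuspDim, if_pos (even_two_mul M)]
  omega

/-- This is the coefficient form of multiplication by `(1 - x^4)(1 - x^6) = 1 - x^4 - x^6 + x^10`,
with negative terms moved across to stay in `ℕ`. -/
theorem cuspDim_recurrence (n : ℕ) : cuspDim n + (if 10 ≤ n then cuspDim (n - 10) else 0) =
    (if n = 12 then 1 else 0) + ((if 4 ≤ n then cuspDim (n - 4) else 0) +
      if 6 ≤ n then cuspDim (n - 6) else 0) := by
  obtain ⟨M, rfl | rfl⟩ := Nat.even_or_odd' n
  · rcases lt_or_ge M 5 with hs | hs
    · interval_cases M <;> rfl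
    · obtain ⟨L, rfl⟩ := Nat.exists_eq_add_of_le hs
      rw [if_pos (show 10 ≤ 2 * (5 + L) by omega), if_pos (show 4 ≤ 2 * (5 + L) by omega),
        if_pos (show 6 ≤ 2 * (5 + L) by omega),
        show 2 * (5 + L) - 10 = 2 * L by omega, show 2 * (5 + L) - 4 = 2 * (3 + L) by omega,
        show 2 * (5 + L) - 6 = 2 * (2 + L) by omega]
      simp only [cuspDim_two_mul]
      -- The divisions by 2 and by 3 become linear on each residue class modulo 6.
      obtain ⟨Q, r, hr, rfl⟩ : ∃ Q r, r < 6 ∧ L = 6 * Q + r :=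
        ⟨L / 6, L % 6, Nat.mod_lt _ (by norm_num), by omega⟩
      interval_cases r <;> split_ifs <;> omega
  · have h : ∀ j, (if 2 * j ≤ 2 * M + 1 then cuspDim (2 * M + 1 - 2 * j) else 0) = 0 := fun j => by
      split_ifs
      · exact cuspDim_of_odd (by omega)
      · rfl
    rw [cuspDim_of_odd (by omega), h 5, h 2, h 3, if_neg (by omega)]

theorem cuspSeries_eq : cuspSeries = PowerSeries.mk fun n => (cuspDim n : ℚ) := by
  symm
  rw [cuspSeries, PowerSeries.eq_mul_inv_iff_mul_eq (by simp)]
  have h : ∀ p : PowerSeries ℚ, p * ((1 - PowerSeries.X ^ 4) * (1 - PowerSeries.X ^ 6)) =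
      p + p * PowerSeries.X ^ 10 - (p * PowerSeries.X ^ 4 + p * PowerSeries.X ^ 6) :=
    fun p => by ring
  rw [h]
  ext n
  rw [map_sub, map_add, map_add, PowerSeries.coeff_mul_X_pow', PowerSeries.coeff_mul_X_pow',
    PowerSeries.coeff_mul_X_pow', PowerSeries.coeff_X_pow, sub_eq_iff_eq_add]
  simp only [PowerSeries.coeff_mk]
  exact_mod_cast cuspDim_recurrence n

theorem cuspDim_le_finrank_vecW (N : ℕ) :
    cuspDim N ≤ Module.finrank ℚ (vecW N 2 le_rfl) := by
  unfold cuspDim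
  split_ifs with h
  · exact le_finrank_vecW h
  · exact Nat.zero_le _

theorem coeff_mul_nonneg {φ ψ : PowerSeries ℚ} (hφ : ∀ n, 0 ≤ PowerSeries.coeff n φ)
    (hψ : ∀ n, 0 ≤ PowerSeries.coeff n ψ) (n : ℕ) : 0 ≤ PowerSeries.coeff n (φ * ψ) := by
  rw [PowerSeries.coeff_mul]
  exact Finset.sum_nonneg fun x _ => mul_nonneg (hφ _) (hψ _)

theorem coeff_add_nonneg {φ ψ : PowerSeries ℚ} (hφ : ∀ n, 0 ≤ PowerSeries.coeff n φ)
    (hψ : ∀ n, 0 ≤ PowerSeries.coeff n ψ) (n : ℕ) : 0 ≤ PowerSeries.coeff n (φ + ψ) := by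
  rw [map_add]
  exact add_nonneg (hφ _) (hψ _)

/-- The estimate for the generating series that results from the two kernel estimates. -/
theorem coeff_le_of_kernel_estimates {k w q K₃ K₄ : ℕ → ℕ}
    (hq : ∀ n, q n + k n = (S n 2).card) (hwt : ∀ n, w n ≤ (S n 2).card) (hwk : ∀ n, w n ≤ k n)
    (hsw : ∀ n, cuspDim n ≤ w n)
    (h₃ : ∀ n, ∑ x ∈ Finset.HasAntidiagonal.antidiagonal n, (S x.1 1).card * k x.2 +
      ∑ x ∈ Finset.HasAntidiagonal.antidiagonal n, w x.1 * (S x.2 1).card ≤ K₃ n)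
    (h₄ : ∀ n, ∑ x ∈ Finset.HasAntidiagonal.antidiagonal n, (S x.1 1).card * K₃ x.2 +
      ∑ x ∈ Finset.HasAntidiagonal.antidiagonal n, w x.1 * q x.2 ≤ K₄ n) (N : ℕ) :
    PowerSeries.coeff N (3 * oddSeries ^ 2 * cuspSeries - cuspSeries ^ 2) ≤ (K₄ N : ℚ) := by
  let ser (u : ℕ → ℕ) : PowerSeries ℚ := PowerSeries.mk fun n => (u n : ℚ)
  have hser : ∀ u n, PowerSeries.coeff n (ser u) = u n := fun u n => PowerSeries.coeff_mk _ _
  have hmul : ∀ u u' n, PowerSeries.coeff n (ser u * ser u') =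
      ((∑ x ∈ Finset.HasAntidiagonal.antidiagonal n, u x.1 * u' x.2 : ℕ) : ℚ) := fun u u' n => by
    rw [PowerSeries.coeff_mul]
    simp [hser]
  have hO : oddSeries = ser fun n => (S n 1).card := oddSeries_eq
  have hO2 : oddSeries ^ 2 = ser fun n => (S n 2).card := oddSeries_sq
  have hs : cuspSeries = ser cuspDim := cuspSeries_eq
  have hq' : ser q = oddSeries ^ 2 - ser k := by
    ext n
    rw [hO2, map_sub, hser, hser, hser, ← hq]
    push_cast
    ring
  have p1 : ∀ n, 0 ≤ PowerSeries.coeff n (ser K₃ - (oddSeries * ser k + ser w * oddSeries)) := by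
    intro n
    rw [map_sub, map_add, hO, hmul, hmul, hser, sub_nonneg]
    exact_mod_cast h₃ n
  have p2 : ∀ n, 0 ≤ PowerSeries.coeff n (ser K₄ - (oddSeries * ser K₃ + ser w * ser q)) := by
    intro n
    rw [map_sub, map_add, hO, hmul, hmul, hser, sub_nonneg]
    exact_mod_cast h₄ n
  have pO : ∀ n, 0 ≤ PowerSeries.coeff n oddSeries := fun n => by
    rw [hO, hser]; positivity
  have pwO : ∀ n, 0 ≤ PowerSeries.coeff n (oddSeries ^ 2 - ser w) := fun n => by
    rw [map_sub, hO2, hser, hser, sub_nonneg]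
    exact_mod_cast hwt n
  have pO2 : ∀ n, 0 ≤ PowerSeries.coeff n (oddSeries ^ 2) := fun n => by
    rw [hO2, hser]; positivity
  have pkw : ∀ n, 0 ≤ PowerSeries.coeff n (ser k - ser w) := fun n => by
    rw [map_sub, hser, hser, sub_nonneg]
    exact_mod_cast hwk n
  have pws : ∀ n, 0 ≤ PowerSeries.coeff n (ser w - cuspSeries) := fun n => by
    rw [map_sub, hs, hser, hser, sub_nonneg]
    exact_mod_cast hsw n
  -- The difference of the two sides is `(K₄ - O K₃ - w q) + O (K₃ - O k - w O) + (k - w)(O² - w) +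
  -- (w - S)(3O² - w - S)`, where the last factor is written as `O² + 2(O² - w) + (w - S)`.
  have hfin := coeff_add_nonneg (coeff_add_nonneg p2 (coeff_mul_nonneg pO p1))
    (coeff_add_nonneg (coeff_mul_nonneg pkw pwO) (coeff_mul_nonneg pws
      (coeff_add_nonneg pO2 (coeff_add_nonneg pwO (coeff_add_nonneg pwO pws))))) N
  rw [← hser K₄ N, ← sub_nonneg, ← map_sub]
  convert hfin using 2
  rw [hq']
  ring

end Series

/-! ### Outer products of coefficient vectors -/

section Outer

/-- Extension of a vector by zero to all tuples. -/
def extendZero {a p : ℕ} (v : Vect a p) (m : Fin p → ℕ) : ℚ :=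
  if h : m ∈ S a p then v ⟨m, h⟩ else 0

theorem extendZero_coe {a p : ℕ} (v : Vect a p) (m : S a p) : extendZero v m.1 = v m :=
  dif_pos m.2

theorem extendZero_of_notMem {a p : ℕ} (v : Vect a p) {m : Fin p → ℕ} (h : m ∉ S a p) :
    extendZero v m = 0 :=
  dif_neg h

/-- The outer product of two coefficient vectors, which corresponds to the product of two
polynomials in disjoint sets of variables. -/
def outer (N : ℕ) {a b p q : ℕ} (v : Vect a p) (w : Vect b q) : Vect N (p + q) := fun n =>
  extendZero v (fun i => n.1 (Fin.castAdd q i)) * extendZero w (fun i => n.1 (Fin.natAdd p i))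

theorem append_mem_S {N a b p q : ℕ} (h : a + b = N) {m : Fin p → ℕ} {n : Fin q → ℕ}
    (hm : m ∈ S a p) (hn : n ∈ S b q) : Fin.append m n ∈ S N (p + q) := by
  rw [mem_S] at *
  refine ⟨by simp [Fin.sum_univ_add, hm.1, hn.1, h], fun i => ?_⟩
  refine Fin.addCases (fun i => ?_) (fun i => ?_) i
  · simpa using hm.2 i
  · simpa using hn.2 i

theorem outer_append {N a b p q : ℕ} (v : Vect a p) (w : Vect b q) {m : Fin p → ℕ}
    {n : Fin q → ℕ} (h : Fin.append m n ∈ S N (p + q)) :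
    outer N v w ⟨Fin.append m n, h⟩ = extendZero v m * extendZero w n := by
  simp [outer]

theorem append_castAdd_natAdd {p q : ℕ} (n : Fin (p + q) → ℕ) :
    Fin.append (fun i => n (Fin.castAdd q i)) (fun i => n (Fin.natAdd p i)) = n := by
  ext i
  refine Fin.addCases (fun i => ?_) (fun i => ?_) i <;> simp

theorem sum_outer_smul {M : Type*} [AddCommGroup M] [Module ℚ M] {N a b p q : ℕ} (h : a + b = N)
    (v : Vect a p) (w : Vect b q) (g : (Fin (p + q) → ℕ) → M) :
    ∑ n : S N (p + q), outer N v w n • g n.1 =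
      ∑ m : S a p, ∑ n : S b q, (v m * w n) • g (Fin.append m.1 n.1) := by
  rw [← Fintype.sum_prod_type' (f := fun (m : S a p) (n : S b q) =>
    (v m * w n) • g (Fin.append m.1 n.1))]
  symm
  refine Fintype.sum_of_injective
    (fun x : S a p × S b q => (⟨Fin.append x.1.1 x.2.1, append_mem_S h x.1.2 x.2.2⟩ : S N (p + q)))
    ?_ _ _ ?_ ?_
  · intro x y hxy
    have h1 : Fin.append x.1.1 x.2.1 = Fin.append y.1.1 y.2.1 := congrArg Subtype.val hxy
    refine Prod.ext (Subtype.ext (funext fun i => ?_)) (Subtype.ext (funext fun i => ?_))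
    · simpa using congrFun h1 (Fin.castAdd q i)
    · simpa using congrFun h1 (Fin.natAdd p i)
  · intro n hn
    by_cases h1 : (fun i => n.1 (Fin.castAdd q i)) ∈ S a p
    · by_cases h2 : (fun i => n.1 (Fin.natAdd p i)) ∈ S b q
      · exact absurd ⟨(⟨_, h1⟩, ⟨_, h2⟩), Subtype.ext (append_castAdd_natAdd n.1)⟩ hn
      · rw [outer, extendZero_of_notMem _ h2, mul_zero, zero_smul]
    · rw [outer, extendZero_of_notMem _ h1, zero_mul, zero_smul]
  · intro x
    rw [outer_append, extendZero_coe, extendZero_coe]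

theorem monomial_expo_append {p q : ℕ} (m : Fin p → ℕ) (n : Fin q → ℕ) :
    monomial (expo (Fin.append m n)) (1 : ℚ) =
      rename (Fin.castAdd q) (monomial (expo m) 1) *
        rename (Fin.natAdd p) (monomial (expo n) 1) := by
  rw [rename_monomial, rename_monomial, monomial_mul, mul_one]
  refine congrArg (fun d => monomial d (1 : ℚ)) ?_
  ext i
  rw [Finsupp.add_apply, expo_apply]
  refine Fin.addCases (fun i => ?_) (fun i => ?_) i
  · rw [Finsupp.mapDomain_apply (Fin.castAdd_injective p q), Finsupp.mapDomain_of_notMem_range,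
      Fin.append_left, add_zero, expo_apply]
    rintro ⟨j, hj⟩
    have := congrArg Fin.val hj
    have := i.2
    simp at *
    omega
  · rw [Finsupp.mapDomain_apply (Fin.natAdd_injective q p), Finsupp.mapDomain_of_notMem_range,
      Fin.append_right, zero_add, expo_apply]
    rintro ⟨j, hj⟩
    have := congrArg Fin.val hj
    have := j.2
    simp at *
    omega

theorem toPoly_outer {N a b p q : ℕ} (h : a + b = N) (v : Vect a p) (w : Vect b q) :
    toPoly N (p + q) (outer N v w) =
      rename (Fin.castAdd q) (toPoly a p v) * rename (Fin.natAdd p) (toPoly b q w) := by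
  rw [toPoly_apply, sum_outer_smul h v w (fun n => monomial (expo n) (1 : ℚ)), toPoly_apply,
    toPoly_apply, map_sum, map_sum, Finset.sum_mul_sum]
  refine Finset.sum_congr rfl fun m _ => Finset.sum_congr rfl fun n _ => ?_
  rw [monomial_expo_append, map_smul, map_smul, smul_mul_smul_comm]

/-- The relation defining `W` involves only the first two variables, so it survives multiplication
by a polynomial in the others. -/
theorem outer_mem_vecW {N a b q : ℕ} (h : a + b = N) {v : Vect a 2} (hv : v ∈ vecW a 2 le_rfl)
    (w : Vect b q) : outer N v w ∈ vecW N (2 + q) (Nat.le_add_right 2 q) := by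
  rw [mem_vecW] at hv ⊢
  have hA : ∀ P : MvPolynomial (Fin 2) ℚ, substA (Nat.le_add_right 2 q)
      (rename (Fin.castAdd q) P) = rename (Fin.castAdd q) (substA le_rfl P) := by
    intro P
    rw [← AlgHom.comp_apply, ← AlgHom.comp_apply]
    congr 1
    refine algHom_ext fun i => ?_
    simp only [AlgHom.comp_apply, rename_X, substA, aeval_X, Fin.val_castAdd]
    fin_cases i
    · simp
      rfl
    · simp
  have hB : ∀ P : MvPolynomial (Fin 2) ℚ, substB (Nat.le_add_right 2 q)
      (rename (Fin.castAdd q) P) = rename (Fin.castAdd q) (substB le_rfl P) := by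
    intro P
    rw [← AlgHom.comp_apply, ← AlgHom.comp_apply]
    congr 1
    refine algHom_ext fun i => ?_
    fin_cases i <;> simp [substB] <;> rfl
  have hA' : ∀ P : MvPolynomial (Fin q) ℚ, substA (Nat.le_add_right 2 q)
      (rename (Fin.natAdd 2) P) = rename (Fin.natAdd 2) P := by
    intro P
    rw [← AlgHom.comp_apply]
    congr 1
    refine algHom_ext fun i => ?_
    simp only [AlgHom.comp_apply, rename_X, substA, aeval_X, Fin.val_natAdd]
    rw [if_neg (by omega)]
  have hB' : ∀ P : MvPolynomial (Fin q) ℚ, substB (Nat.le_add_right 2 q)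
      (rename (Fin.natAdd 2) P) = rename (Fin.natAdd 2) P := by
    intro P
    rw [← AlgHom.comp_apply]
    congr 1
    refine algHom_ext fun i => ?_
    simp only [AlgHom.comp_apply, rename_X, substB, aeval_X, Fin.val_natAdd]
    rw [if_neg (by omega), if_neg (by omega)]
  rw [toPoly_outer h, map_mul, map_mul, hA, hB, hA', hB', ← sub_mul, ← map_sub, ← hv]

/-- For `j ≤ q` the matrix `E^(j)` fixes the first `p` entries, so it acts on the second factor
alone. -/
theorem vecMul_outer_Ej {N a b p q j : ℕ} (h : a + b = N) (v : Vect a p) (w : Vect b q)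
    (hj : j ≤ q) (hj' : j ≤ p + q) :
    Matrix.vecMul (outer N v w) (Ej N (p + q) j hj') =
      outer N v (Matrix.vecMul w (Ej b q j hj)) := by
  ext n
  set n₁ : Fin p → ℕ := fun i => n.1 (Fin.castAdd q i) with hn₁
  set n₂ : Fin q → ℕ := fun i => n.1 (Fin.natAdd p i) with hn₂
  have hlast : ∀ m : Fin (p + q) → ℕ, lastEntries j hj' m =
      lastEntries j hj fun i => m (Fin.natAdd p i) := fun m => by
    ext k
    simp only [lastEntries]
    congr 1
    ext
    simp
    omega
  have hcond : ∀ (m₁ : Fin p → ℕ) (m₂ : Fin q → ℕ),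
      (∀ i : Fin (p + q), i.val < p + q - j → Fin.append m₁ m₂ i = n.1 i) ↔
        m₁ = n₁ ∧ ∀ i : Fin q, i.val < q - j → m₂ i = n₂ i := by
    intro m₁ m₂
    constructor
    · intro hc
      refine ⟨funext fun i => ?_, fun i hi => ?_⟩
      · simpa using hc (Fin.castAdd q i) (by have := i.2; simp; omega)
      · simpa using hc (Fin.natAdd p i) (by simp; omega)
    · rintro ⟨h1, h2⟩ i
      refine Fin.addCases (fun i _ => ?_) (fun i hi => ?_) i
      · simp [h1, hn₁]
      · simpa using h2 i (by simp at hi; omega)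
  have hL := sum_outer_smul h v w fun m : Fin (p + q) → ℕ =>
    ((if ∀ i : Fin (p + q), i.val < p + q - j → m i = n.1 i then (1 : ℚ) else 0) *
      e (lastEntries j hj' m) (lastEntries j hj' n.1))
  have hL' : Matrix.vecMul (outer N v w) (Ej N (p + q) j hj') n = _ := hL
  rw [hL']
  simp only [hcond, hlast, Fin.append_right]
  change _ = extendZero v n₁ * extendZero _ n₂
  by_cases h1 : n₁ ∈ S a p
  · have h2 : n₂ ∈ S b q := by
      have hn := mem_S.1 n.2
      have hs := (mem_S.1 h1).1
      rw [Fin.sum_univ_add] at hn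
      refine mem_S.2 ⟨?_, fun i => hn.2 _⟩
      simp only [hn₁, hn₂] at hs ⊢
      omega
    rw [Finset.sum_eq_single ⟨n₁, h1⟩]
    · have e1 := extendZero_coe v ⟨n₁, h1⟩
      have e2 := extendZero_coe (Matrix.vecMul w (Ej b q j hj)) ⟨n₂, h2⟩
      simp only at e1 e2
      rw [e1, e2]
      change _ = _ * ∑ m : S b q, w m * _
      rw [Finset.mul_sum]
      refine Finset.sum_congr rfl fun m _ => ?_
      simp only [true_and, smul_eq_mul, Ej, Matrix.of_apply]
      rw [mul_assoc]
    · intro m _ hm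
      have : m.1 ≠ n₁ := fun hc => hm (Subtype.ext hc)
      simp [this]
    · simp
  · rw [extendZero_of_notMem _ h1, zero_mul]
    refine Finset.sum_eq_zero fun m _ => Finset.sum_eq_zero fun m' _ => ?_
    have : m.1 ≠ n₁ := fun hc => h1 (hc ▸ m.2)
    simp [this]

theorem Ej_self (N r : ℕ) : Ej N r r le_rfl = E N r := by
  ext m n
  have h : ∀ m : Fin r → ℕ, lastEntries r le_rfl m = m := fun m => by
    ext k
    simp [lastEntries]
  simp [Ej, E, h]

/-- Outer products of basis vectors are independent: different splittings `a + b = N` have disjoint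
supports, and within one splitting the independence is that of a tensor product of bases. -/
theorem sum_finrank_mul_le {N p q : ℕ} (A : ∀ a, Submodule ℚ (Vect a p))
    (B : ∀ b, Submodule ℚ (Vect b q)) (U : Submodule ℚ (Vect N (p + q)))
    (h : ∀ a b, a + b = N → ∀ v ∈ A a, ∀ w ∈ B b, outer N v w ∈ U) :
    ∑ x ∈ Finset.HasAntidiagonal.antidiagonal N,
      Module.finrank ℚ (A x.1) * Module.finrank ℚ (B x.2) ≤ Module.finrank ℚ U := by
  let bA := fun a => Module.finBasis ℚ (A a)
  let bB := fun b => Module.finBasis ℚ (B b)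
  let u : (Σ x : Finset.HasAntidiagonal.antidiagonal N,
      Fin (Module.finrank ℚ (A x.1.1)) × Fin (Module.finrank ℚ (B x.1.2))) → U := fun i =>
    ⟨outer N (bA i.1.1.1 i.2.1).1 (bB i.1.1.2 i.2.2).1,
      h _ _ (Finset.HasAntidiagonal.mem_antidiagonal.1 i.1.2) _ (Subtype.prop _) _ (Subtype.prop _)⟩
  have hu : LinearIndependent ℚ u := by
    rw [Fintype.linearIndependent_iff]
    rintro g hg ⟨x, i, j⟩
    have h1 : ∀ (m : S x.1.1 p) (n : S x.1.2 q),
        ∑ i, ∑ j, g ⟨x, i, j⟩ * ((bA x.1.1 i).1 m * (bB x.1.2 j).1 n) = 0 := by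
      intro m n
      have hx := Finset.HasAntidiagonal.mem_antidiagonal.1 x.2
      have h2 := congrFun (congrArg Subtype.val hg)
        ⟨Fin.append m.1 n.1, append_mem_S hx m.2 n.2⟩
      rw [Fintype.sum_sigma] at h2
      simp only [Submodule.coe_sum, Submodule.coe_smul, Finset.sum_apply, Pi.smul_apply,
        outer_append, u, Submodule.coe_zero, Pi.zero_apply, smul_eq_mul] at h2
      rw [Finset.sum_eq_single x, Fintype.sum_prod_type] at h2
      · simpa only [extendZero_coe] using h2
      -- The sum of the first `p` entries determines the splitting, so terms from other splittings
      -- vanish on this tuple.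
      · intro y _ hy
        refine Finset.sum_eq_zero fun k _ => ?_
        rw [extendZero_of_notMem, zero_mul, mul_zero]
        intro hm
        have h3 := (mem_S.1 hm).1
        have h4 := (mem_S.1 m.2).1
        have h5 := Finset.HasAntidiagonal.mem_antidiagonal.1 y.2
        exact hy (Subtype.ext (Prod.ext (by omega) (by omega)))
      · simp
    have h2 : ∀ (n : S x.1.2 q) i, ∑ j, g ⟨x, i, j⟩ * (bB x.1.2 j).1 n = 0 := by
      intro n
      refine Fintype.linearIndependent_iff.1 (bA x.1.1).linearIndependent _ ?_
      ext m
      simp only [Submodule.coe_sum, Submodule.coe_smul, Finset.sum_apply, Pi.smul_apply,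
        smul_eq_mul, Finset.sum_mul, Submodule.coe_zero, Pi.zero_apply]
      rw [← h1 m n]
      exact Finset.sum_congr rfl fun i _ => Finset.sum_congr rfl fun j _ => by ring
    refine Fintype.linearIndependent_iff.1 (bB x.1.2).linearIndependent (fun j => g ⟨x, i, j⟩) ?_ j
    ext n
    simpa using h2 n i
  have hcard := hu.fintype_card_le_finrank
  rw [Fintype.card_sigma] at hcard
  simp only [Fintype.card_prod, Fintype.card_fin] at hcard
  rwa [Finset.sum_coe_sort (Finset.HasAntidiagonal.antidiagonal N)
    (fun x => Module.finrank ℚ (A x.1) * Module.finrank ℚ (B x.2))] at hcard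

end Outer

/-! ### The Ihara action as an operator on polynomials -/

section Operators

variable {s : ℕ}

/-- Substitution of `x_{i+1} - x_i` for the first variable and of all variables but `x_p` for the
others. -/
noncomputable def diffSubst (i : Fin s) (p : Fin (s + 1)) :
    MvPolynomial (Fin (s + 1)) ℚ →ₐ[ℚ] MvPolynomial (Fin (s + 1)) ℚ :=
  aeval (Fin.cons (X i.succ - X i.castSucc) fun k => X (p.succAbove k))

/-- The linear operator `f ⊗ g ↦ f ∘ g`, where `f ⊗ g` is identified with `f(x_1) g(x_2, …)`. -/
noncomputable def iharaOp (s : ℕ) :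
    MvPolynomial (Fin (s + 1)) ℚ →ₗ[ℚ] MvPolynomial (Fin (s + 1)) ℚ :=
  LinearMap.id + ∑ i : Fin s,
    ((diffSubst i i.succ).toLinearMap - (diffSubst i i.castSucc).toLinearMap)

/-- The substitution `diffSubst` applied to all variables but the first. -/
noncomputable def tailDiffSubst (i : Fin s) (p : Fin (s + 1)) :
    MvPolynomial (Fin (s + 2)) ℚ →ₐ[ℚ] MvPolynomial (Fin (s + 2)) ℚ :=
  aeval (Fin.cons (X 0)
    (Fin.cons (X i.succ.succ - X i.castSucc.succ) fun k => X (p.succAbove k).succ))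

/-- The operator `iharaOp` applied to all variables but the first. -/
noncomputable def tailIharaOp (s : ℕ) :
    MvPolynomial (Fin (s + 2)) ℚ →ₗ[ℚ] MvPolynomial (Fin (s + 2)) ℚ :=
  LinearMap.id + ∑ i : Fin s,
    ((tailDiffSubst i i.succ).toLinearMap - (tailDiffSubst i i.castSucc).toLinearMap)

theorem iharaOp_apply (P : MvPolynomial (Fin (s + 1)) ℚ) :
    iharaOp s P = P + ∑ i : Fin s, (diffSubst i i.succ P - diffSubst i i.castSucc P) := by
  simp [iharaOp]

theorem tailIharaOp_apply (P : MvPolynomial (Fin (s + 2)) ℚ) :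
    tailIharaOp s P =
      P + ∑ i : Fin s, (tailDiffSubst i i.succ P - tailDiffSubst i i.castSucc P) := by
  simp [tailIharaOp]

theorem aeval_cons_monomial {A : Type*} [CommRing A] [Algebra ℚ A] (u : A) (g : Fin s → A)
    (d : Fin (s + 1) →₀ ℕ) :
    aeval (Fin.cons u g : Fin (s + 1) → A) (monomial d (1 : ℚ)) =
      u ^ d 0 * aeval g (monomial d.tail (1 : ℚ)) := by
  rw [aeval_monomial, aeval_monomial, Finsupp.prod_fintype _ _ (by simp),
    Finsupp.prod_fintype _ _ (by simp), Fin.prod_univ_succ]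
  simp [Finsupp.tail_apply]

theorem rename_eq_aeval {p : ℕ} (f : Fin s → Fin p) (P : MvPolynomial (Fin s) ℚ) :
    rename f P = aeval (fun k => (X (f k) : MvPolynomial (Fin p) ℚ)) P := by
  exact DFunLike.congr_fun (algHom_ext fun i => by simp) P

theorem monomial_eq_X_pow_mul_rename (d : Fin (s + 1) →₀ ℕ) :
    monomial d (1 : ℚ) = X 0 ^ d 0 * rename Fin.succ (monomial d.tail (1 : ℚ)) := by
  rw [rename_eq_aeval, ← aeval_cons_monomial]
  have : (Fin.cons (X 0) fun k : Fin s => X k.succ :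
      Fin (s + 1) → MvPolynomial (Fin (s + 1)) ℚ) = X := by
    ext i : 1
    refine Fin.cases ?_ (fun i => ?_) i <;> simp
  rw [this, aeval_X_left_apply]

theorem diffSubst_monomial (i : Fin s) (p : Fin (s + 1)) (d : Fin (s + 1) →₀ ℕ) :
    diffSubst i p (monomial d 1) =
      (X i.succ - X i.castSucc) ^ d 0 * rename p.succAbove (monomial d.tail (1 : ℚ)) := by
  rw [diffSubst, aeval_cons_monomial, rename_eq_aeval]

/-- The sign `(-1)^a` turns `(x_i - x_{i+1})^a` into `(x_{i+1} - x_i)^a`, so both terms for a given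
`i` substitute the same difference. -/
theorem ihara_monomial (d : Fin (s + 1) →₀ ℕ) :
    ihara (d 0) (monomial d.tail 1) = iharaOp s (monomial d 1) := by
  rw [ihara, iharaOp_apply, ← monomial_eq_X_pow_mul_rename]
  congr 1
  refine Finset.sum_congr rfl fun i _ => ?_
  rw [diffSubst_monomial, diffSubst_monomial, ← mul_pow, neg_one_mul, neg_sub]

theorem tailDiffSubst_monomial (i : Fin s) (p : Fin (s + 1)) (d : Fin (s + 2) →₀ ℕ) :
    tailDiffSubst i p (monomial d 1) =
      X 0 ^ d 0 * rename Fin.succ (diffSubst i p (monomial d.tail (1 : ℚ))) := by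
  rw [tailDiffSubst, aeval_cons_monomial, diffSubst]
  congr 1
  rw [← AlgHom.comp_apply, comp_aeval]
  congr 2
  ext k : 1
  refine Fin.cases ?_ (fun k => ?_) k <;> simp

theorem tailIharaOp_monomial (d : Fin (s + 2) →₀ ℕ) :
    tailIharaOp s (monomial d 1) =
      X 0 ^ d 0 * rename Fin.succ (iharaOp s (monomial d.tail (1 : ℚ))) := by
  rw [tailIharaOp_apply, iharaOp_apply, map_add, mul_add, ← monomial_eq_X_pow_mul_rename, map_sum,
    Finset.mul_sum]
  simp only [tailDiffSubst_monomial, map_sub, mul_sub]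

theorem coeff_X_pow_mul_rename_succ (a : ℕ) (Q : MvPolynomial (Fin s) ℚ)
    (n : Fin (s + 1) →₀ ℕ) :
    coeff n (X 0 ^ a * rename Fin.succ Q) = if n 0 = a then coeff n.tail Q else 0 := by
  induction Q using MvPolynomial.induction_on' with
  | monomial t c =>
    have h := monomial_eq_X_pow_mul_rename (Finsupp.cons a t)
    rw [Finsupp.cons_zero, Finsupp.tail_cons] at h
    have hc : monomial t c = c • monomial t (1 : ℚ) := by rw [smul_monomial, smul_eq_mul, mul_one]
    rw [hc, map_smul, mul_smul_comm, ← h, coeff_smul, coeff_smul, coeff_monomial, coeff_monomial]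
    by_cases h0 : n 0 = a
    · have : Finsupp.cons a t = n ↔ t = n.tail := by
        constructor
        · rintro rfl
          rw [Finsupp.tail_cons]
        · rintro rfl
          rw [← h0, Finsupp.cons_tail]
      simp [this, h0]
    · have : Finsupp.cons a t ≠ n := by
        rintro rfl
        exact h0 (Finsupp.cons_zero _ _)
      simp [this, h0]
  | add p q hp hq =>
    rw [map_add, mul_add, coeff_add, hp, hq, coeff_add]
    split_ifs <;> simp

theorem e_eq_coeff (m n : Fin (s + 1) → ℕ) :
    e m n = coeff (expo n) (iharaOp s (monomial (expo m) 1)) := by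
  rw [← ihara_monomial]
  rfl

theorem vecMul_E {N : ℕ} (v : Vect N (s + 1)) (n : S N (s + 1)) :
    Matrix.vecMul v (E N (s + 1)) n = coeff (expo n.1) (iharaOp s (toPoly N (s + 1) v)) := by
  rw [toPoly_apply, map_sum, coeff_sum]
  change ∑ m, v m * E N (s + 1) m n = _
  refine Finset.sum_congr rfl fun m _ => ?_
  rw [map_smul, coeff_smul, smul_eq_mul, ← e_eq_coeff]
  rfl

theorem Ej_tail {N : ℕ} (h : s + 1 ≤ s + 2) (m n : S N (s + 2)) :
    Ej N (s + 2) (s + 1) h m n = coeff (expo n.1) (tailIharaOp s (monomial (expo m.1) 1)) := by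
  have hlast : ∀ m : Fin (s + 2) → ℕ, lastEntries (s + 1) h m = fun i => m i.succ := fun m => by
    ext k
    simp only [lastEntries]
    congr 1
    ext
    simp
    omega
  have hcond : (∀ i : Fin (s + 2), i.val < s + 2 - (s + 1) → m.1 i = n.1 i) ↔
      expo n.1 0 = expo m.1 0 := by
    have h1 := ((mem_S.1 m.2).2 0).1
    have h2 := ((mem_S.1 n.2).2 0).1
    rw [expo_apply, expo_apply]
    constructor
    · intro hc
      rw [hc 0 (by simp)]
    · intro hc i hi
      have : i = 0 := Fin.ext (show i.val = 0 by omega)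
      subst this
      omega
  rw [tailIharaOp_monomial, coeff_X_pow_mul_rename_succ, Ej, Matrix.of_apply]
  simp only [hcond, hlast]
  rw [e_eq_coeff, ite_mul, one_mul, zero_mul]
  rfl

theorem vecMul_Ej_tail {N : ℕ} (h : s + 1 ≤ s + 2) (v : Vect N (s + 2)) (n : S N (s + 2)) :
    Matrix.vecMul v (Ej N (s + 2) (s + 1) h) n =
      coeff (expo n.1) (tailIharaOp s (toPoly N (s + 2) v)) := by
  rw [toPoly_apply, map_sum, coeff_sum]
  change ∑ m, v m * Ej N (s + 2) (s + 1) h m n = _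
  refine Finset.sum_congr rfl fun m _ => ?_
  rw [map_smul, coeff_smul, smul_eq_mul, ← Ej_tail h]

/-! ### Restriction to even exponents -/

/-- A variable that does not occur in the substituted difference keeps its exponent exactly; this is
homogeneity for the weight supported on that variable. -/
theorem coeff_diffSubst_monomial_eq_zero {i : Fin s} {p : Fin (s + 1)} {j : Fin s}
    (h1 : p.succAbove j ≠ i.succ) (h2 : p.succAbove j ≠ i.castSucc) {d n : Fin (s + 1) →₀ ℕ}
    (hn : n (p.succAbove j) ≠ d j.succ) : coeff n (diffSubst i p (monomial d 1)) = 0 := by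
  classical
  set w : Fin (s + 1) → ℕ := Pi.single (p.succAbove j) 1 with hw
  have hX : ∀ k, k ≠ p.succAbove j →
      IsWeightedHomogeneous w (X k : MvPolynomial (Fin (s + 1)) ℚ) 0 := fun k hk => by
    have := isWeightedHomogeneous_X ℚ w k
    rwa [hw, Pi.single_eq_of_ne hk] at this
  have hu : IsWeightedHomogeneous w
      ((X i.succ - X i.castSucc : MvPolynomial (Fin (s + 1)) ℚ) ^ d 0) 0 := by
    simpa using ((hX _ h1.symm).sub (hX _ h2.symm)).pow (d 0)
  have hm : IsWeightedHomogeneous w (rename p.succAbove (monomial d.tail (1 : ℚ))) (d j.succ) := by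
    rw [rename_monomial]
    apply isWeightedHomogeneous_monomial
    rw [Finsupp.weight_apply, Finsupp.sum_fintype _ _ (by simp),
      Finset.sum_eq_single (p.succAbove j)]
    · rw [Finsupp.mapDomain_apply Fin.succAbove_right_injective, hw, Pi.single_eq_same]
      simp [Finsupp.tail_apply]
    · intro k _ hk
      rw [hw, Pi.single_eq_of_ne hk, smul_zero]
    · simp
  rw [diffSubst_monomial]
  refine (hu.mul hm).coeff_eq_zero n ?_
  rw [Finsupp.weight_apply, Finsupp.sum_fintype _ _ (by simp), zero_add,
    Finset.sum_eq_single (p.succAbove j)]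
  · rw [hw, Pi.single_eq_same]
    simpa using hn
  · intro k _ hk
    rw [hw, Pi.single_eq_of_ne hk, smul_zero]
  · simp

theorem coeff_diffSubst_monomial_eq_zero_of_ne {i j : Fin s} (hij : j ≠ i)
    {d n : Fin (s + 1) →₀ ℕ} (hn : ∀ q, n q ≠ d j.succ) :
    coeff n (diffSubst i i.succ (monomial d 1)) = 0 ∧
      coeff n (diffSubst i i.castSucc (monomial d 1)) = 0 := by
  have hij' : j.val ≠ i.val := fun h => hij (Fin.ext h)
  refine ⟨coeff_diffSubst_monomial_eq_zero ?_ ?_ (hn _),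
    coeff_diffSubst_monomial_eq_zero ?_ ?_ (hn _)⟩ <;>
  · simp only [Fin.succAbove, Fin.lt_def, Ne, Fin.ext_iff]
    split_ifs <;> simp at * <;> omega

/-- A monomial of even degree and even in the first variable that is odd in, or independent of,
one of the other variables does not contribute to the totally even restricted part. -/
theorem coeff_iharaOp_monomial_eq_zero {d n : Fin (s + 1) →₀ ℕ} (hn : ∀ i, Even (n i) ∧ n i ≠ 0)
    (hd0 : Even (d 0)) (hd : Even (∑ i, d i)) {j : Fin s} (hj : Odd (d j.succ) ∨ d j.succ = 0) :
    coeff n (iharaOp s (monomial d 1)) = 0 := by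
  have hodd : ∀ {k : Fin s}, Odd (d k.succ) → ∀ q, n q ≠ d k.succ := fun hk q hq =>
    (Nat.not_even_iff_odd.2 hk) (hq ▸ (hn q).1)
  have hne : ∀ q, n q ≠ d j.succ := by
    rcases hj with hj | hj
    · exact hodd hj
    · intro q
      rw [hj]
      exact (hn q).2
  rw [iharaOp_apply, coeff_add, coeff_monomial, if_neg fun h => hne j.succ (by rw [h]), zero_add,
    coeff_sum]
  refine Finset.sum_eq_zero fun i _ => ?_
  rw [coeff_sub]
  -- For `j ≠ i` the bad exponent survives in an untouched variable. Only the variable moved by the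
  -- `i`-th pair of substitutions needs another argument.
  by_cases hij : j = i
  · subst hij
    rcases hj with hj | hj
    -- Even total degree and even first exponent force a second odd exponent, now in an untouched
    -- variable.
    · obtain ⟨k, hk, hkj⟩ : ∃ k, Odd (d (Fin.succ k)) ∧ k ≠ j := by
        by_contra! hc
        rw [Fin.sum_univ_succ, ← Finset.add_sum_erase _ _ (Finset.mem_univ j)] at hd
        have h1 : Even (∑ k ∈ Finset.univ.erase j, d (Fin.succ k)) :=
          Finset.even_sum _ fun k hk => by
            by_contra hk'
            exact (Finset.mem_erase.1 hk).1 (hc k (Nat.not_even_iff_odd.1 hk'))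
        have h2 : Odd (d 0 + (d j.succ + ∑ k ∈ Finset.univ.erase j, d (Fin.succ k))) :=
          hd0.add_odd (hj.add_even h1)
        exact (Nat.not_even_iff_odd.2 h2) hd
      have := coeff_diffSubst_monomial_eq_zero_of_ne hkj (hodd hk)
      rw [this.1, this.2, sub_zero]
    -- The two substitutions differ only in the image of this variable, which is absent, so their
    -- difference vanishes.
    · rw [sub_eq_zero, diffSubst_monomial, diffSubst_monomial, rename_eq_aeval, rename_eq_aeval,
        aeval_monomial, aeval_monomial, Finsupp.prod_fintype _ _ (by simp),
        Finsupp.prod_fintype _ _ (by simp)]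
      congr 3
      refine Finset.prod_congr rfl fun k _ => ?_
      by_cases hk : k = j
      · rw [hk, Finsupp.tail_apply, hj, pow_zero, pow_zero]
      · have hk' : k.val ≠ j.val := fun h => hk (Fin.ext h)
        congr 2
        simp only [Fin.succAbove, Fin.lt_def]
        split_ifs <;> simp at * <;> omega
  · have := coeff_diffSubst_monomial_eq_zero_of_ne hij hne
    rw [this.1, this.2, sub_zero]

theorem isHomogeneous_tailIharaOp {k : ℕ} {P : MvPolynomial (Fin (s + 2)) ℚ}
    (hP : P.IsHomogeneous k) : (tailIharaOp s P).IsHomogeneous k := by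
  have hd : ∀ i p, (tailDiffSubst (s := s) i p P).IsHomogeneous k := fun i p => by
    have := hP.aeval (n := 1) (Fin.cons (X 0)
      (Fin.cons (X i.succ.succ - X i.castSucc.succ) fun k => X (p.succAbove k).succ) :
        Fin (s + 2) → MvPolynomial (Fin (s + 2)) ℚ) (by
      intro j
      refine Fin.cases ?_ (fun j => Fin.cases ?_ (fun j => ?_) j) j
      · exact isHomogeneous_X _ _
      · exact (isHomogeneous_X _ _).sub (isHomogeneous_X _ _)
      · exact isHomogeneous_X _ _)
    rwa [one_mul] at this
  rw [tailIharaOp_apply]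
  exact hP.add (IsHomogeneous.sum _ _ _ fun i _ => (hd _ _).sub (hd _ _))

/-- `D` is the part lost when `tailIharaOp` is truncated to a vector. Its monomials keep the even
first exponent and the even total degree of `m`, so each has an odd or zero exponent elsewhere and
is invisible after `iharaOp`. -/
theorem coeff_iharaOp_single {N : ℕ} (h : s + 1 ≤ s + 2) (m n : S N (s + 2)) :
    coeff (expo n.1) (iharaOp (s + 1) (toPoly N (s + 2)
      (Matrix.vecMul (Pi.single m 1) (Ej N (s + 2) (s + 1) h)))) =
    coeff (expo n.1) (iharaOp (s + 1) (tailIharaOp s (monomial (expo m.1) 1))) := by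
  set u := Matrix.vecMul (Pi.single m 1) (Ej N (s + 2) (s + 1) h) with hu
  set D := tailIharaOp s (monomial (expo m.1) 1) - toPoly N (s + 2) u with hD
  suffices h0 : coeff (expo n.1) (iharaOp (s + 1) D) = 0 by
    rw [hD, map_sub, coeff_sub, sub_eq_zero] at h0
    exact h0.symm
  have hm := mem_S.1 m.2
  rw [D.as_sum, map_sum, coeff_sum]
  refine Finset.sum_eq_zero fun d hd => ?_
  rw [← mul_one (coeff d D), ← smul_eq_mul, ← smul_monomial, map_smul, coeff_smul]
  rw [mem_support_iff] at hd
  have hnot : ∀ k : S N (s + 2), expo k.1 ≠ d := by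
    rintro k rfl
    apply hd
    rw [hD, coeff_sub, coeff_toPoly, hu, vecMul_Ej_tail, toPoly_single, sub_self]
  rw [hD, coeff_sub, coeff_toPoly_eq_zero _ hnot, sub_zero] at hd
  have hd0 : d 0 = m.1 0 - 1 := by
    by_contra hc
    rw [tailIharaOp_monomial, coeff_X_pow_mul_rename_succ, expo_apply, if_neg hc] at hd
    exact hd rfl
  have hsum : ∑ i, d i = ∑ i, (m.1 i - 1) := by
    have hhom := isHomogeneous_tailIharaOp (s := s)
      (isHomogeneous_monomial (R := ℚ) (d := expo m.1) 1 rfl)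
    have := hhom hd
    simp only [Finsupp.weight_apply, Finsupp.degree_eq_sum] at this
    rw [Finsupp.sum_fintype _ _ (by simp)] at this
    simpa [expo_apply] using this
  have heven : ∀ i, Even (m.1 i - 1) := fun i => Nat.Odd.sub_odd (hm.2 i).2 odd_one
  have hbad : ∃ j : Fin (s + 1), Odd (d j.succ) ∨ d j.succ = 0 := by
    by_contra! hc
    have hgood : ∀ i, Even (d i) ∧ d i ≠ 0 := by
      intro i
      refine Fin.cases ?_ (fun j => ?_) i
      · rw [hd0]
        have := (hm.2 0).1
        exact ⟨heven 0, by omega⟩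
      · exact ⟨Nat.not_odd_iff_even.1 (hc j).1, (hc j).2⟩
    refine hnot ⟨fun i => d i + 1, mem_S.2 ⟨?_, fun i => ?_⟩⟩ ?_
    · rw [← hm.1, Finset.sum_add_distrib, hsum, ← Finset.sum_add_distrib]
      refine Finset.sum_congr rfl fun i _ => ?_
      have := (hm.2 i).1
      omega
    · obtain ⟨⟨k, hk⟩, h2⟩ := hgood i
      exact ⟨by omega, k, by omega⟩
    · ext i
      simp [expo_apply]
  obtain ⟨j, hj⟩ := hbad
  have hn : ∀ i, Even (expo n.1 i) ∧ expo n.1 i ≠ 0 := fun i => by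
    have := (mem_S.1 n.2).2 i
    rw [expo_apply]
    exact ⟨Nat.Odd.sub_odd this.2 odd_one, by omega⟩
  rw [coeff_iharaOp_monomial_eq_zero hn (hd0 ▸ heven 0)
    (hsum ▸ Finset.even_sum _ fun i _ => heven i) hj, smul_zero]

theorem vecMul_Ej_tail_vecMul_E {N : ℕ} (h : s + 1 ≤ s + 2) (v : Vect N (s + 2))
    (n : S N (s + 2)) :
    Matrix.vecMul (Matrix.vecMul v (Ej N (s + 2) (s + 1) h)) (E N (s + 2)) n =
      coeff (expo n.1) (iharaOp (s + 1) (tailIharaOp s (toPoly N (s + 2) v))) := by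
  rw [vecMul_E]
  let f : Vect N (s + 2) →ₗ[ℚ] ℚ := lcoeff ℚ (expo n.1) ∘ₗ iharaOp (s + 1) ∘ₗ toPoly N (s + 2) ∘ₗ
    (Ej N (s + 2) (s + 1) h).vecMulLinear
  let g : Vect N (s + 2) →ₗ[ℚ] ℚ := lcoeff ℚ (expo n.1) ∘ₗ iharaOp (s + 1) ∘ₗ tailIharaOp s ∘ₗ
    toPoly N (s + 2)
  have hfg : f = g := by
    refine LinearMap.pi_ext' fun m => LinearMap.ext_ring ?_
    have := coeff_iharaOp_single h m n
    rw [← toPoly_single] at this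
    exact this
  exact LinearMap.congr_fun hfg v

end Operators

/-! ### The operators on three and four variables -/

section Identities

variable {A : Type*} [CommRing A] [Algebra ℚ A]

theorem aeval_neg_toPoly {N r : ℕ} (v : Vect N r) {z z' : Fin r → A} (i : Fin r)
    (hi : z' i = -z i) (hz : ∀ j, j ≠ i → z' j = z j) :
    aeval z' (toPoly N r v) = aeval z (toPoly N r v) := by
  rw [toPoly_apply, map_sum, map_sum]
  refine Finset.sum_congr rfl fun m _ => ?_
  rw [map_smul, map_smul, aeval_monomial, aeval_monomial, Finsupp.prod_fintype _ _ (by simp),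
    Finsupp.prod_fintype _ _ (by simp)]
  congr 2
  refine Finset.prod_congr rfl fun j _ => ?_
  by_cases hj : j = i
  · rw [hj, hi, expo_apply, (Nat.Odd.sub_odd ((mem_S.1 m.2).2 i).2 odd_one).neg_pow]
  · rw [hz j hj]

theorem aeval_relation {N r : ℕ} {hr : 2 ≤ r} {v : Vect N r} (hv : v ∈ vecW N r hr)
    {z zA zB : Fin r → A}
    (hA : ∀ i : Fin r, zA i = if i.val = 0 then z ⟨1, by omega⟩ - z ⟨0, by omega⟩ else z i)
    (hB : ∀ i : Fin r, zB i = if i.val = 0 then z ⟨1, by omega⟩ - z ⟨0, by omega⟩ else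
      if i.val = 1 then z ⟨0, by omega⟩ else z i) :
    aeval z (toPoly N r v) = aeval zA (toPoly N r v) - aeval zB (toPoly N r v) := by
  have h := congrArg (aeval z) (mem_vecW.1 hv)
  rw [map_sub, substA, substB, ← AlgHom.comp_apply, ← AlgHom.comp_apply, comp_aeval,
    comp_aeval] at h
  convert h using 4
  · ext i
    rw [hA]
    split_ifs <;> simp
  · ext i
    rw [hB]
    split_ifs <;> simp

theorem aeval_diffSubst {s : ℕ} (i : Fin s) (p : Fin (s + 1)) (z : Fin (s + 1) → A)
    (P : MvPolynomial (Fin (s + 1)) ℚ) :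
    aeval z (diffSubst i p P) =
      aeval (Fin.cons (z i.succ - z i.castSucc) fun k => z (p.succAbove k) : Fin (s + 1) → A) P := by
  rw [diffSubst, ← AlgHom.comp_apply, comp_aeval]
  congr 2
  ext k
  refine Fin.cases ?_ (fun k => ?_) k <;> simp

theorem aeval_tailDiffSubst {s : ℕ} (i : Fin s) (p : Fin (s + 1)) (z : Fin (s + 2) → A)
    (P : MvPolynomial (Fin (s + 2)) ℚ) :
    aeval z (tailDiffSubst i p P) =
      aeval (Fin.cons (z 0) (Fin.cons (z i.succ.succ - z i.castSucc.succ)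
        fun k => z (p.succAbove k).succ) : Fin (s + 2) → A) P := by
  rw [tailDiffSubst, ← AlgHom.comp_apply, comp_aeval]
  congr 2
  ext k
  refine Fin.cases ?_ (fun k => Fin.cases ?_ (fun k => ?_) k) k <;> simp

theorem aeval_iharaOp_three (Q : MvPolynomial (Fin 3) ℚ) (a b c : A) :
    aeval ![a, b, c] (iharaOp 2 Q) = aeval ![a, b, c] Q +
      (aeval ![b - a, a, c] Q - aeval ![b - a, b, c] Q +
        (aeval ![c - b, a, b] Q - aeval ![c - b, a, c] Q)) := by
  rw [iharaOp_apply, map_add, map_sum, Fin.sum_univ_two]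
  simp only [map_sub, aeval_diffSubst]
  congr! 6 <;> (ext k; fin_cases k <;> rfl)

theorem aeval_tailIharaOp_three (Q : MvPolynomial (Fin 3) ℚ) (a b c : A) :
    aeval ![a, b, c] (tailIharaOp 1 Q) = aeval ![a, b, c] Q +
      (aeval ![a, c - b, b] Q - aeval ![a, c - b, c] Q) := by
  rw [tailIharaOp_apply, map_add, map_sum, Fin.sum_univ_one]
  simp only [map_sub, aeval_tailDiffSubst]
  congr! 5
  all_goals
    ext k
    fin_cases k <;> rfl

theorem aeval_iharaOp_four (Q : MvPolynomial (Fin 4) ℚ) (a b c d : A) :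
    aeval ![a, b, c, d] (iharaOp 3 Q) = aeval ![a, b, c, d] Q +
      (aeval ![b - a, a, c, d] Q - aeval ![b - a, b, c, d] Q +
        (aeval ![c - b, a, b, d] Q - aeval ![c - b, a, c, d] Q) +
          (aeval ![d - c, a, b, c] Q - aeval ![d - c, a, b, d] Q)) := by
  rw [iharaOp_apply, map_add, map_sum, Fin.sum_univ_three]
  simp only [map_sub, aeval_diffSubst]
  refine congrArg₂ _ rfl (congrArg₂ _ (congrArg₂ _ (congrArg₂ _ ?_ ?_) (congrArg₂ _ ?_ ?_))
    (congrArg₂ _ ?_ ?_))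
  all_goals
    refine congrArg (fun z : Fin 4 → A => aeval z Q) (funext fun k => ?_)
    fin_cases k <;> rfl

theorem aeval_tailIharaOp_four (Q : MvPolynomial (Fin 4) ℚ) (a b c d : A) :
    aeval ![a, b, c, d] (tailIharaOp 2 Q) = aeval ![a, b, c, d] Q +
      (aeval ![a, c - b, b, d] Q - aeval ![a, c - b, c, d] Q +
        (aeval ![a, d - c, b, c] Q - aeval ![a, d - c, b, d] Q)) := by
  rw [tailIharaOp_apply, map_add, map_sum, Fin.sum_univ_two]
  simp only [map_sub, aeval_tailDiffSubst]
  congr! 6 <;> (ext k; fin_cases k <;> rfl)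

theorem relation_three {N : ℕ} {v : Vect N 3} (hv : v ∈ vecW N 3 (by omega)) {a b d : A}
    (hd : d = b - a) (c : A) :
    aeval ![a, b, c] (toPoly N 3 v) =
      aeval ![d, b, c] (toPoly N 3 v) - aeval ![d, a, c] (toPoly N 3 v) := by
  subst hd
  apply aeval_relation hv <;> intro i <;> fin_cases i <;> rfl

/-- Exchanging `a` and `b` swaps the two terms on the right of the relation, up to the sign of `b -
a`, in which the polynomial is even. -/
theorem antisymm_three {N : ℕ} {v : Vect N 3} (hv : v ∈ vecW N 3 (by omega)) (a b c : A) :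
    aeval ![a, b, c] (toPoly N 3 v) = -aeval ![b, a, c] (toPoly N 3 v) := by
  have hneg : ∀ y, aeval ![a - b, y, c] (toPoly N 3 v) = aeval ![b - a, y, c] (toPoly N 3 v) :=
    fun y => aeval_neg_toPoly v 0 (by simp) fun j hj => by fin_cases j <;> simp_all
  rw [relation_three hv rfl c, relation_three hv (a := b) rfl c, hneg, hneg]
  ring

theorem relation_four {N : ℕ} {v : Vect N 4} (hv : v ∈ vecW N 4 (by omega)) {a b e : A}
    (he : e = b - a) (c d : A) :
    aeval ![a, b, c, d] (toPoly N 4 v) =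
      aeval ![e, b, c, d] (toPoly N 4 v) - aeval ![e, a, c, d] (toPoly N 4 v) := by
  subst he
  apply aeval_relation hv <;> intro i <;> fin_cases i <;> rfl

theorem antisymm_four {N : ℕ} {v : Vect N 4} (hv : v ∈ vecW N 4 (by omega)) (a b c d : A) :
    aeval ![a, b, c, d] (toPoly N 4 v) = -aeval ![b, a, c, d] (toPoly N 4 v) := by
  have hneg : ∀ y, aeval ![a - b, y, c, d] (toPoly N 4 v) =
      aeval ![b - a, y, c, d] (toPoly N 4 v) :=
    fun y => aeval_neg_toPoly v 0 (by simp) fun j hj => by fin_cases j <;> simp_all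
  rw [relation_four hv rfl c, relation_four hv (a := b) rfl c, hneg, hneg]
  ring

end Identities

/-! ### Operator identities on `W` in depths three and four -/

theorem aeval_vec_three (P : MvPolynomial (Fin 3) ℚ) :
    aeval ![(X 0 : MvPolynomial (Fin 3) ℚ), X 1, X 2] P = P := by
  have : (![X 0, X 1, X 2] : Fin 3 → MvPolynomial (Fin 3) ℚ) = X := by
    ext i : 1
    fin_cases i <;> rfl
  rw [this, aeval_X_left_apply]

theorem aeval_vec_four (P : MvPolynomial (Fin 4) ℚ) :
    aeval ![(X 0 : MvPolynomial (Fin 4) ℚ), X 1, X 2, X 3] P = P := by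
  have : (![X 0, X 1, X 2, X 3] : Fin 4 → MvPolynomial (Fin 4) ℚ) = X := by
    ext i : 1
    fin_cases i <;> rfl
  rw [this, aeval_X_left_apply]

/-- The identity and the first pair of substitutions in `iharaOp` cancel by the relation of `W`. The
other pair is, by antisymmetry in the first two arguments, the negative of the correction in
`tailIharaOp`. Depth four works alike. -/
theorem iharaOp_add_tailIharaOp_three {N : ℕ} {v : Vect N 3} (hv : v ∈ vecW N 3 (by omega)) :
    iharaOp 2 (toPoly N 3 v) + tailIharaOp 1 (toPoly N 3 v) = toPoly N 3 v := by
  rw [← aeval_vec_three (iharaOp 2 _), ← aeval_vec_three (tailIharaOp 1 _), aeval_iharaOp_three,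
    aeval_tailIharaOp_three]
  conv_rhs => rw [← aeval_vec_three (toPoly N 3 v)]
  generalize (X 0 : MvPolynomial (Fin 3) ℚ) = a, (X 1 : MvPolynomial (Fin 3) ℚ) = b,
    (X 2 : MvPolynomial (Fin 3) ℚ) = c
  linear_combination relation_three hv (a := a) (b := b) rfl c + antisymm_three hv a (c - b) b -
    antisymm_three hv a (c - b) c

theorem iharaOp_tailIharaOp_three {N : ℕ} {v : Vect N 3} (hv : v ∈ vecW N 3 (by omega)) :
    iharaOp 2 (tailIharaOp 1 (toPoly N 3 v)) = 0 := by
  rw [← aeval_vec_three (iharaOp 2 _)]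
  simp only [aeval_iharaOp_three, aeval_tailIharaOp_three]
  generalize (X 0 : MvPolynomial (Fin 3) ℚ) = a, (X 1 : MvPolynomial (Fin 3) ℚ) = b,
    (X 2 : MvPolynomial (Fin 3) ℚ) = c
  -- This lets the relation of `W` be applied to the pair `(b - a, c - a)`, which arises on
  -- composing the two operators.
  have hd : c - b = (c - a) - (b - a) := by ring
  linear_combination relation_three hv (a := a) (b := b) rfl c + antisymm_three hv a (c - b) b -
    antisymm_three hv a (c - b) c - antisymm_three hv (b - a) (c - b) b +
    antisymm_three hv (b - a) (c - b) c + relation_three hv hd a - relation_three hv hd c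

theorem iharaOp_add_tailIharaOp_four {N : ℕ} {v : Vect N 4} (hv : v ∈ vecW N 4 (by omega)) :
    iharaOp 3 (toPoly N 4 v) + tailIharaOp 2 (toPoly N 4 v) = toPoly N 4 v := by
  rw [← aeval_vec_four (iharaOp 3 _), ← aeval_vec_four (tailIharaOp 2 _), aeval_iharaOp_four,
    aeval_tailIharaOp_four]
  conv_rhs => rw [← aeval_vec_four (toPoly N 4 v)]
  generalize (X 0 : MvPolynomial (Fin 4) ℚ) = a, (X 1 : MvPolynomial (Fin 4) ℚ) = b,
    (X 2 : MvPolynomial (Fin 4) ℚ) = c, (X 3 : MvPolynomial (Fin 4) ℚ) = d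
  linear_combination relation_four hv (a := a) (b := b) rfl c d +
    antisymm_four hv a (c - b) b d - antisymm_four hv a (c - b) c d +
    antisymm_four hv a (d - c) b c - antisymm_four hv a (d - c) b d

theorem iharaOp_tailIharaOp_four {N : ℕ} {v : Vect N 4} (hv : v ∈ vecW N 4 (by omega)) :
    iharaOp 3 (tailIharaOp 2 (toPoly N 4 v)) = 0 := by
  rw [← aeval_vec_four (iharaOp 3 _)]
  simp only [aeval_iharaOp_four, aeval_tailIharaOp_four]
  generalize (X 0 : MvPolynomial (Fin 4) ℚ) = a, (X 1 : MvPolynomial (Fin 4) ℚ) = b,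
    (X 2 : MvPolynomial (Fin 4) ℚ) = c, (X 3 : MvPolynomial (Fin 4) ℚ) = d
  -- Besides `(a, b)`, the relation is needed for the pairs `(b - a, c - a)` and `(c - b, d - b)`;
  -- antisymmetry cancels the rest.
  have h₁ : c - b = (c - a) - (b - a) := by ring
  have h₂ : d - c = (d - b) - (c - b) := by ring
  linear_combination relation_four hv (a := a) (b := b) rfl c d +
    antisymm_four hv a (c - b) b d - antisymm_four hv a (c - b) c d +
    antisymm_four hv a (d - c) b c - antisymm_four hv a (d - c) b d +
    antisymm_four hv (b - a) (d - c) a c - antisymm_four hv (b - a) (d - c) a d -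
    antisymm_four hv (b - a) (d - c) b c + antisymm_four hv (b - a) (d - c) b d -
    antisymm_four hv (b - a) (c - b) b d + antisymm_four hv (b - a) (c - b) c d -
    antisymm_four hv (c - b) (d - c) a c + antisymm_four hv (c - b) (d - c) a d +
    relation_four hv h₁ a d - relation_four hv h₁ c d +
    relation_four hv h₂ a b - relation_four hv h₂ a d

/-! ### Estimates for the kernels -/

section Kernels

theorem vecMul_F_eq {N s : ℕ} (h : s + 1 ≤ s + 2) {v : Vect N (s + 2)}
    (hv : iharaOp (s + 1) (toPoly N (s + 2) v) + tailIharaOp s (toPoly N (s + 2) v) =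
      toPoly N (s + 2) v) :
    Matrix.vecMul v (F N (s + 2)) = -Matrix.vecMul v (Ej N (s + 2) (s + 1) h) := by
  ext n
  rw [F, Matrix.vecMul_sub, Matrix.vecMul_one, Pi.sub_apply, Pi.neg_apply, vecMul_E,
    vecMul_Ej_tail, ← coeff_toPoly v n]
  have := congrArg (coeff (expo n.1)) hv
  rw [coeff_add] at this
  linarith

theorem vecMul_F_vecMul_E {N s : ℕ} {v : Vect N (s + 2)}
    (hv : iharaOp (s + 1) (toPoly N (s + 2) v) + tailIharaOp s (toPoly N (s + 2) v) =
      toPoly N (s + 2) v)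
    (hv' : iharaOp (s + 1) (tailIharaOp s (toPoly N (s + 2) v)) = 0) :
    Matrix.vecMul (Matrix.vecMul v (F N (s + 2))) (E N (s + 2)) = 0 := by
  ext n
  rw [vecMul_F_eq (Nat.le_succ _) hv, Matrix.neg_vecMul, Pi.neg_apply, vecMul_Ej_tail_vecMul_E,
    hv', coeff_zero, neg_zero]
  rfl

/-- The map `f` sends `ker (g ∘ f)` onto `range f ∩ ker g`, which contains `D`, with kernel `ker f`.
-/
theorem finrank_ker_add_finrank_le {M : Type*} [AddCommGroup M] [Module ℚ M]
    [FiniteDimensional ℚ M] {f g : M →ₗ[ℚ] M} {D : Submodule ℚ M} (hf : D ≤ LinearMap.range f)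
    (hg : D ≤ LinearMap.ker g) :
    Module.finrank ℚ (LinearMap.ker f) + Module.finrank ℚ D ≤
      Module.finrank ℚ (LinearMap.ker (g ∘ₗ f)) := by
  have hK : LinearMap.ker f ≤ LinearMap.ker (g ∘ₗ f) := fun x hx => by
    rw [LinearMap.mem_ker] at hx
    rw [LinearMap.mem_ker, LinearMap.comp_apply, hx, map_zero]
  have h1 := LinearMap.finrank_range_add_finrank_ker (f.domRestrict (LinearMap.ker (g ∘ₗ f)))
  have h2 : D ≤ LinearMap.range (f.domRestrict (LinearMap.ker (g ∘ₗ f))) := by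
    intro x hx
    obtain ⟨y, rfl⟩ := hf hx
    exact ⟨⟨y, hg hx⟩, rfl⟩
  have h3 : Module.finrank ℚ (LinearMap.ker f) ≤
      Module.finrank ℚ (LinearMap.ker (f.domRestrict (LinearMap.ker (g ∘ₗ f)))) :=
    LinearMap.finrank_le_finrank_of_injective
      (f := (Submodule.inclusion hK).codRestrict
        (LinearMap.ker (f.domRestrict (LinearMap.ker (g ∘ₗ f)))) fun x => x.2)
      fun x y hxy => Subtype.ext (congrArg (fun z => z.1.1) hxy)
  have h4 := Submodule.finrank_mono h2
  omega

/-- Here `D` is the image of `X` under `F`; the injectivity assumption makes its dimension that of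
`X`. -/
theorem finrank_ker_add_finrank_vecW_le {N r : ℕ} {hr : 2 ≤ r}
    (hinj : ∀ v ∈ vecW N r hr, Matrix.vecMul v (F N r) = 0 → v = 0)
    {f : Vect N r →ₗ[ℚ] Vect N r} {X : Submodule ℚ (Vect N r)} (hX : X ≤ vecW N r hr)
    (hf : ∀ v ∈ X, Matrix.vecMul v (F N r) ∈ LinearMap.range f)
    (hE : ∀ v ∈ X, Matrix.vecMul (Matrix.vecMul v (F N r)) (E N r) = 0) :
    Module.finrank ℚ (LinearMap.ker f) + Module.finrank ℚ X ≤
      Module.finrank ℚ (LinearMap.ker ((E N r).vecMulLinear ∘ₗ f)) := by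
  have h : Function.Injective ((F N r).vecMulLinear.domRestrict X) := by
    rw [← LinearMap.ker_eq_bot, LinearMap.ker_eq_bot']
    exact fun v hv => Subtype.ext (hinj v.1 (hX v.2) hv)
  rw [← LinearMap.finrank_range_of_inj h]
  apply finrank_ker_add_finrank_le
  · rintro _ ⟨v, rfl⟩
    exact hf v.1 v.2
  · rintro _ ⟨v, rfl⟩
    exact hE v.1 v.2

theorem outer_zero (N : ℕ) {a b p q : ℕ} (v : Vect a p) : outer N v (0 : Vect b q) = 0 := by
  ext n
  simp [outer, extendZero]

theorem finrank_top_vect (a p : ℕ) :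
    Module.finrank ℚ (⊤ : Submodule ℚ (Vect a p)) = (S a p).card := by
  rw [finrank_top, Module.finrank_fintype_fun_eq_card, Fintype.card_coe]

/-- In depth two the vanishing of `iharaOp` is literally the relation of `W`. -/
theorem vecW_two_le_ker (N : ℕ) : vecW N 2 le_rfl ≤ LinearMap.ker (E N 2).vecMulLinear := by
  intro v hv
  have hA : diffSubst (0 : Fin 1) (Fin.castSucc 0) = substA le_rfl := by
    refine algHom_ext fun i => ?_
    fin_cases i <;> simp [diffSubst, substA]
  have hB : diffSubst (0 : Fin 1) (Fin.succ 0) = substB le_rfl := by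
    refine algHom_ext fun i => ?_
    fin_cases i <;> simp [diffSubst, substB]
  have h : iharaOp 1 (toPoly N 2 v) = 0 := by
    rw [iharaOp_apply, Fin.sum_univ_one, hA, hB]
    linear_combination mem_vecW.1 hv
  rw [LinearMap.mem_ker]
  ext n
  change Matrix.vecMul v (E N 2) n = 0
  rw [vecMul_E, h, coeff_zero]

theorem vecMul_F_injective {r : ℕ} (hr : 2 ≤ r)
    (hinj : ∀ N : ℕ, 0 < N → Function.Injective (tasakaMap N r hr)) (N : ℕ) :
    ∀ v ∈ vecW N r hr, Matrix.vecMul v (F N r) = 0 → v = 0 := by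
  intro v hv h
  -- The hypothesis covers `N > 0` only; for `N = 0` the index set is empty.
  rcases Nat.eq_zero_or_pos N with rfl | hN
  · ext n
    have h1 := mem_S.1 n.2
    have h2 : n.1 ⟨0, by omega⟩ ≤ ∑ i, n.1 i :=
      Finset.single_le_sum (fun i _ => Nat.zero_le _) (Finset.mem_univ _)
    have h3 := (h1.2 ⟨0, by omega⟩).1
    omega
  · exact eq_zero_of_vecMul_F (hinj N hN) hv h

/-- The left action of `C` in depth three. -/
noncomputable def leftC₃ (N : ℕ) : Vect N 3 →ₗ[ℚ] Vect N 3 :=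
  (E N 3).vecMulLinear ∘ₗ (Ej N 3 2 (by omega)).vecMulLinear

/-- The left action of `C` in depth four. -/
noncomputable def leftC₄ (N : ℕ) : Vect N 4 →ₗ[ℚ] Vect N 4 :=
  (E N 4).vecMulLinear ∘ₗ
    ((Ej N 4 3 (by omega)).vecMulLinear ∘ₗ (Ej N 4 2 (by omega)).vecMulLinear)

/-- The first sum comes from `ker E^(2)`, which contains all products of a depth-one vector with the
left kernel of `E_{b,2}`. The second comes from `W_{N,3}`, all of which is admissible because `vF =
-vE^(2)` is automatically in the image of `E^(2)`. -/
theorem le_finrank_ker_leftC₃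
    (hinj : ∀ N : ℕ, 0 < N → Function.Injective (tasakaMap N 3 (by omega))) (N : ℕ) :
    ∑ x ∈ Finset.HasAntidiagonal.antidiagonal N,
        (S x.1 1).card * Module.finrank ℚ (LinearMap.ker (E x.2 2).vecMulLinear) +
      ∑ x ∈ Finset.HasAntidiagonal.antidiagonal N,
        Module.finrank ℚ (vecW x.1 2 le_rfl) * (S x.2 1).card ≤
      Module.finrank ℚ (LinearMap.ker (leftC₃ N)) := by
  refine le_trans (add_le_add ?_ ?_) (finrank_ker_add_finrank_vecW_le
    (vecMul_F_injective (by omega) hinj N) (X := vecW N 3 (by omega)) le_rfl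
    (f := (Ej N 3 2 (by omega)).vecMulLinear) (fun v hv => ?_) fun v hv =>
      vecMul_F_vecMul_E (iharaOp_add_tailIharaOp_three hv) (iharaOp_tailIharaOp_three hv))
  · simp only [← finrank_top_vect]
    refine sum_finrank_mul_le (p := 1) (q := 2) (fun _ => ⊤)
      (fun b => LinearMap.ker (E b 2).vecMulLinear) _ fun a b h v _ w hw => ?_
    have hw' : Matrix.vecMul w (E b 2) = 0 := hw
    change Matrix.vecMul (outer N v w) (Ej N (1 + 2) 2 (by omega)) = 0
    rw [vecMul_outer_Ej h v w le_rfl, Ej_self, hw', outer_zero]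
  · simp only [← finrank_top_vect]
    exact sum_finrank_mul_le (p := 2) (q := 1) (fun a => vecW a 2 le_rfl) (fun _ => ⊤) _
      fun a b h v hv w _ => outer_mem_vecW h hv w
  · rw [vecMul_F_eq (Nat.le_succ _) (iharaOp_add_tailIharaOp_three hv)]
    exact neg_mem ⟨v, rfl⟩

theorem le_finrank_ker_leftC₄
    (hinj : ∀ N : ℕ, 0 < N → Function.Injective (tasakaMap N 4 (by omega))) (N : ℕ) :
    ∑ x ∈ Finset.HasAntidiagonal.antidiagonal N,
        (S x.1 1).card * Module.finrank ℚ (LinearMap.ker (leftC₃ x.2)) +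
      ∑ x ∈ Finset.HasAntidiagonal.antidiagonal N,
        Module.finrank ℚ (vecW x.1 2 le_rfl) *
          Module.finrank ℚ (LinearMap.range (E x.2 2).vecMulLinear) ≤
      Module.finrank ℚ (LinearMap.ker (leftC₄ N)) := by
  refine le_trans (add_le_add ?_ ?_) (finrank_ker_add_finrank_vecW_le
    (vecMul_F_injective (by omega) hinj N)
    -- For `vF = -vE^(3)` to lie in the image of `E^(2)E^(3)`, it suffices that `v` lies in that of
    -- `E^(2)`. This is why the second factor of the outer products is restricted to the row space
    -- of `E_{b,2}`.
    (X := vecW N 4 (by omega) ⊓ LinearMap.range (Ej N 4 2 (by omega)).vecMulLinear) inf_le_left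
    (f := (Ej N 4 3 (by omega)).vecMulLinear ∘ₗ (Ej N 4 2 (by omega)).vecMulLinear)
    (fun v hv => ?_) fun v hv =>
      vecMul_F_vecMul_E (iharaOp_add_tailIharaOp_four hv.1) (iharaOp_tailIharaOp_four hv.1))
  · simp only [← finrank_top_vect]
    refine sum_finrank_mul_le (p := 1) (q := 3) (fun _ => ⊤)
      (fun b => LinearMap.ker (leftC₃ b)) _ fun a b h v _ w hw => ?_
    have hw' : Matrix.vecMul (Matrix.vecMul w (Ej b 3 2 (by omega))) (E b 3) = 0 := hw
    change Matrix.vecMul (Matrix.vecMul (outer N v w) (Ej N (1 + 3) 2 (by omega)))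
      (Ej N (1 + 3) 3 (by omega)) = 0
    rw [vecMul_outer_Ej h v w (by omega), vecMul_outer_Ej h _ _ le_rfl, Ej_self, hw', outer_zero]
  · refine sum_finrank_mul_le (p := 2) (q := 2) (fun a => vecW a 2 le_rfl)
      (fun b => LinearMap.range (E b 2).vecMulLinear) _ fun a b h v hv w hw =>
        ⟨outer_mem_vecW h hv w, ?_⟩
    obtain ⟨u, rfl⟩ := hw
    refine ⟨outer N v u, ?_⟩
    change Matrix.vecMul (outer N v u) (Ej N (2 + 2) 2 (by omega)) =
      outer N v (Matrix.vecMul u (E b 2))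
    rw [vecMul_outer_Ej h v u le_rfl, Ej_self]
  · obtain ⟨u, hu⟩ := hv.2
    rw [vecMul_F_eq (Nat.le_succ _) (iharaOp_add_tailIharaOp_four hv.1)]
    refine neg_mem ⟨u, ?_⟩
    rw [LinearMap.comp_apply, hu]
    rfl

/-! ### From right annihilators to left annihilators -/

theorem finrank_ker_mulVecLin_eq {ι : Type*} [Fintype ι] [DecidableEq ι] (M : Matrix ι ι ℚ) :
    Module.finrank ℚ (LinearMap.ker M.mulVecLin) =
      Module.finrank ℚ (LinearMap.ker M.vecMulLinear) := by
  have h1 := LinearMap.finrank_range_add_finrank_ker M.mulVecLin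
  have h2 := LinearMap.finrank_range_add_finrank_ker M.vecMulLinear
  have h3 : Module.finrank ℚ (LinearMap.range M.mulVecLin) =
      Module.finrank ℚ (LinearMap.range M.vecMulLinear) := by
    have h := Matrix.rank_transpose M
    rw [Matrix.rank, Matrix.rank, Matrix.mulVecLin_transpose] at h
    exact h.symm
  omega

theorem vecMulLinear_C_four (N : ℕ) : (C N 4).vecMulLinear = leftC₄ N := by
  ext1 m
  ext1
  simp only [C, leftC₄, List.ofFn_succ, List.ofFn_zero, List.prod_cons, List.prod_nil, mul_one,
    LinearMap.comp_apply, Matrix.vecMulLinear_apply, Matrix.vecMul_vecMul]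
  rfl

end Kernels

end TotallyOdd

theorem mainTheorem2
    (hinj : ∀ (N r : ℕ) (hr : 2 ≤ r), 0 < N →
      Function.Injective (TotallyOdd.tasakaMap N r hr))
    (N : ℕ) (hN : 0 < N) :
    PowerSeries.coeff N
        (3 * TotallyOdd.oddSeries ^ 2 * TotallyOdd.cuspSeries - TotallyOdd.cuspSeries ^ 2) ≤
      (Module.finrank ℚ (LinearMap.ker (TotallyOdd.C N 4).mulVecLin) : ℚ) := by
  rw [TotallyOdd.finrank_ker_mulVecLin_eq, TotallyOdd.vecMulLinear_C_four]
  refine TotallyOdd.coeff_le_of_kernel_estimates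
    (k := fun n => Module.finrank ℚ (LinearMap.ker (TotallyOdd.E n 2).vecMulLinear))
    (w := fun n => Module.finrank ℚ (TotallyOdd.vecW n 2 le_rfl))
    (q := fun n => Module.finrank ℚ (LinearMap.range (TotallyOdd.E n 2).vecMulLinear))
    (K₃ := fun n => Module.finrank ℚ (LinearMap.ker (TotallyOdd.leftC₃ n)))
    (K₄ := fun n => Module.finrank ℚ (LinearMap.ker (TotallyOdd.leftC₄ n)))
    (fun n => ?_) (fun n => ?_) (fun n => Submodule.finrank_mono (TotallyOdd.vecW_two_le_ker n))
    TotallyOdd.cuspDim_le_finrank_vecW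
    (TotallyOdd.le_finrank_ker_leftC₃ fun n hn => hinj n 3 (by omega) hn)
    (TotallyOdd.le_finrank_ker_leftC₄ fun n hn => hinj n 4 (by omega) hn) N
  · rw [LinearMap.finrank_range_add_finrank_ker, Module.finrank_fintype_fun_eq_card,
      Fintype.card_coe]
  · rw [← TotallyOdd.finrank_top_vect]
    exact Submodule.finrank_mono le_top
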